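/- Let $m>0$ and $\omega_{\mathbf p}=\sqrt{|\mathbf p|^2+m^2}$ for $\mathbf p\in\mathbb R^3$. On the bosonic Fock space over $L^2(\mathbb R^3, d^3\mathbf p/(2\omega_{\mathbf p}))$ let $a_c(h)$ be the annihilation operators, $$(a_c(h)\Psi)_k(\mathbf p_1,\dots,\mathbf p_k)=\sqrt{k+1}\int \frac{d^3\mathbf p}{2\omega_{\mathbf p}}\,\overline{h(\mathbf p)}\,\Psi_{k+1}(\mathbf p,\mathbf p_1,\dots,\mathbf p_k),$$ on their maximal domains, write $a_c(h)=\int \frac{d^3\mathbf p}{2\omega_{\mathbf p}}\overline{h(\mathbf p)}a_c(\mathbf p)$, and let $$a(\mathbf p)=\frac{a_c(\mathbf p)}{\sqrt{2\omega_{\mathbf p}}},\qquad \tilde a(\mathbf x)=(2\pi)^{-3/2}\int d^3\mathbf p\,e^{i\mathbf p\cdot\mathbf x}a(\mathbf p)$$ be the coordinate space annihilation operator, an operator-valued distribution: $\tilde a(f)=\int f(\mathbf x)\tilde a(\mathbf x)\,d^3\mathbf x$ for Schwartz functions $f$. For $y=(y^0,\mathbf y)\in\mathbb R^4$ let $U(y,\mathbb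 I)$ be the unitary translation operator, which multiplies a $k$-particle wave function by $\exp\big(i\sum_{j}(\omega_{\mathbf p_j}y^0-\mathbf p_j\cdot\mathbf y)\big)$. Then, as an equality of operator-valued distributions in $\mathbf x$ (and of unbounded operators, including domains, after smearing with a Schwartz function $f(\mathbf x)$), $$U(y,\mathbb I)\,\tilde a(\mathbf x)\,U(y,\mathbb I)^{-1}=(k_{y^0}*\tilde a)(\mathbf x+\mathbf y)=\int d^3\mathbf z\;k_{y^0}(\mathbf x+\mathbf y-\mathbf z)\,\tilde a(\mathbf z),$$ where $k_{y^0}$ is the tempered distribution given by $$k_{y^0}(\mathbf w)=\frac{i y^0}{2\pi^2}\,\frac{m^2K_2\big(m\sqrt{|\mathbf w|^2-(y^0)^2}\big)}{|\mathbf w|^2-(y^0)^2},$$ understood as the boundary value $y^0\to y^0-i0$. That is: 1. For every $\varepsilon>0$ the function $k_{y^0-i\varepsilon}$, defined by the same formula with $y^0$ replaced by $y^0-i\varepsilon$ and the principal square root, is integrable on $\mathbb R^3$, and $\int k_{y^0-i\varepsilon}(\mathbf w)f(\mathbf w)\,d^3\mathbf w\to k_{y^0}(f)$ as $\varepsilon\downarrow0$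 for every Schwartz function $f$. 2. Away from $|\mathbf w|=|y^0|$, $k_{y^0-i\varepsilon}(\mathbf w)$ converges pointwise as $\varepsilon\downarrow 0$ to the function displayed above, and the distribution $k_{y^0}$ coincides with that function, when tested against compactly supported Schwartz functions whose support avoids $|\mathbf w|=|y^0|$. Here $\sqrt{|\mathbf w|^2-(y^0)^2}$ is the positive root for $|\mathbf w|>|y^0|$ and $i\,\mathrm{sgn}(y^0)\sqrt{(y^0)^2-|\mathbf w|^2}$ for $|\mathbf w|<|y^0|$. $K_2$ is the modified Bessel function of the second kind, $K_2(z)=\int_0^\infty e^{-z\cosh u}\cosh(2u)\,du$ for $\mathrm{Re}\,z>0$, extended continuously to the nonzero imaginary axis. 3. The convolution is the distributional one: smearing with $f$ gives $\tilde a(g)$ with $g(\mathbf z)=k_{y^0}\big(f(\,\cdot+\mathbf z-\mathbf y)\big)$, again a Schwartz function. In particular, spatial translations ($y^0=0$) act by a shift: $U((0,\mathbf y),\mathbb I)\,\tilde a(\mathbf x)\,U((0,\mathbf y),\mathbb I)^{-1}=\tilde a(\mathbf x+\mathbf y)$. -/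

import Mathlib

open MeasureTheory Filter Topology
open scoped SchwartzMap FourierTransform ComplexConjugate ENNReal

noncomputable section

section FockSpace

variable {α : Type*} [MeasurableSpace α]

/-- Relabelling the `k` arguments preserves the product measure. -/
theorem measurePreserving_relabel (μ : Measure α) [SigmaFinite μ] {k : ℕ}
    (σ : Equiv.Perm (Fin k)) :
    MeasurePreserving (fun p : Fin k → α => fun i => p (σ i))
      (Measure.pi fun _ : Fin k => μ) (Measure.pi fun _ : Fin k => μ) := by
  have h := (measurePreserving_piCongrLeft (α := fun _ : Fin k => α)
    (fun _ : Fin k => μ) σ).symm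
  have e : (fun p : Fin k → α => fun i => p (σ i)) =
      (MeasurableEquiv.piCongrLeft (fun _ : Fin k => α) σ).symm := by
    funext p i
    rfl
  rw [e]
  exact h

/-- The symmetric `k`-particle space over `L²(α, μ)`: square integrable functions of `k`
variables (for the product measure) that are symmetric almost everywhere. -/
def symmL2 (μ : Measure α) [SigmaFinite μ] (k : ℕ) :
    Submodule ℂ (Lp ℂ 2 (Measure.pi fun _ : Fin k => μ)) where
  carrier := {Ψ | ∀ σ : Equiv.Perm (Fin k),
    (fun p : Fin k → α => Ψ fun i => p (σ i)) =ᵐ[Measure.pi fun _ : Fin k => μ] Ψ}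
  add_mem' := by
    intro Ψ Φ hΨ hΦ σ
    have h := (measurePreserving_relabel μ σ).quasiMeasurePreserving.ae
      (Lp.coeFn_add Ψ Φ)
    filter_upwards [hΨ σ, hΦ σ, h, Lp.coeFn_add Ψ Φ] with p h1 h2 h3 h4
    rw [h3, h4, Pi.add_apply, Pi.add_apply, h1, h2]
  zero_mem' := by
    intro σ
    have h0 := Lp.coeFn_zero ℂ 2 (Measure.pi fun _ : Fin k => μ)
    have h := (measurePreserving_relabel μ σ).quasiMeasurePreserving.ae h0
    filter_upwards [h, h0] with p h3 h4
    rw [h3, h4, Pi.zero_apply, Pi.zero_apply]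
  smul_mem' := by
    intro c Ψ hΨ σ
    have h := (measurePreserving_relabel μ σ).quasiMeasurePreserving.ae
      (Lp.coeFn_smul c Ψ)
    filter_upwards [hΨ σ, h, Lp.coeFn_smul c Ψ] with p h1 h3 h4
    rw [h3, h4, Pi.smul_apply, Pi.smul_apply, h1]

/-- The bosonic Fock space over `L²(α, μ)`: the Hilbert direct sum of the symmetric `k`-particle
spaces, `k = 0, 1, 2, …` (for `k = 0` the space of functions on a point, i.e. `ℂ`). -/
abbrev BosonFock (μ : Measure α) [SigmaFinite μ] : Type _ :=
  lp (fun k : ℕ => symmL2 μ k) 2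

theorem measurePreserving_cons (μ : Measure α) [SigmaFinite μ] (k : ℕ) :
    MeasurePreserving (fun z : (Fin k → α) × α => (Fin.cons z.2 z.1 : Fin (k + 1) → α))
      ((Measure.pi fun _ : Fin k => μ).prod μ) (Measure.pi fun _ : Fin (k + 1) => μ) := by
  have h := ((measurePreserving_piFinSuccAbove (fun _ : Fin (k + 1) => μ) 0).symm).comp
    (Measure.measurePreserving_swap (μ := Measure.pi fun _ : Fin k => μ) (ν := μ))
  convert h using 1
  funext z
  simp [MeasurableEquiv.piFinSuccAbove, Fin.insertNthEquiv]

theorem memLp_section (μ : Measure α) [SigmaFinite μ] {k : ℕ}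
    (Ψ : Lp ℂ 2 (Measure.pi fun _ : Fin (k + 1) => μ)) :
    ∀ᵐ q ∂(Measure.pi fun _ : Fin k => μ), MemLp (fun p : α => Ψ (Fin.cons p q)) 2 μ := by
  have h := (Lp.memLp Ψ).comp_measurePreserving (measurePreserving_cons μ k)
  have h2 := (memLp_two_iff_integrable_sq_norm h.1).1 h
  filter_upwards [h2.prod_right_ae, h.1.prodMk_left] with q h3 h4
  exact (memLp_two_iff_integrable_sq_norm h4).2 h3

/-- The value of the annihilation operator at a `(k+1)`-particle wave function:
`q ↦ √(k+1) ∫ conj (f p) Ψ(p, q₁, …, q_k) dμ(p)`. -/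
def annihFun (μ : Measure α) [SigmaFinite μ] (f : Lp ℂ 2 μ) {k : ℕ}
    (Ψ : Lp ℂ 2 (Measure.pi fun _ : Fin (k + 1) => μ)) (q : Fin k → α) : ℂ :=
  (Real.sqrt (k + 1) : ℂ) * ∫ p, conj (f p) * Ψ (Fin.cons p q) ∂μ

theorem integrable_section (μ : Measure α) [SigmaFinite μ] (f : Lp ℂ 2 μ) {k : ℕ}
    (Ψ : Lp ℂ 2 (Measure.pi fun _ : Fin (k + 1) => μ)) :
    ∀ᵐ q ∂(Measure.pi fun _ : Fin k => μ),
      Integrable (fun p => conj (f p) * Ψ (Fin.cons p q)) μ := by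
  filter_upwards [memLp_section μ Ψ] with q hq
  exact (Lp.memLp f).star.integrable_mul hq

theorem annihFun_memLp (μ : Measure α) [SigmaFinite μ] (f : Lp ℂ 2 μ) {k : ℕ}
    (Ψ : Lp ℂ 2 (Measure.pi fun _ : Fin (k + 1) => μ)) :
    MemLp (annihFun μ f Ψ) 2 (Measure.pi fun _ : Fin k => μ) := by
  have h := (Lp.memLp Ψ).comp_measurePreserving (measurePreserving_cons μ k)
  have hm : AEStronglyMeasurable (fun q : Fin k → α => ∫ p, conj (f p) * Ψ (Fin.cons p q) ∂μ)
      (Measure.pi fun _ : Fin k => μ) := by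
    refine AEStronglyMeasurable.integral_prod_right'
      (f := fun z : (Fin k → α) × α => conj (f z.2) * Ψ (Fin.cons z.2 z.1)) ?_
    exact ((Lp.memLp f).star.1.comp_snd).mul h.1
  refine MemLp.const_mul ?_ _
  have h2 := ((memLp_two_iff_integrable_sq_norm h.1).1 h).integral_prod_left
  rw [memLp_two_iff_integrable_sq_norm hm]
  refine (h2.const_mul (∫ p, ‖f p‖ ^ 2 ∂μ)).mono' (hm.norm.pow 2) ?_
  filter_upwards [memLp_section μ Ψ] with q hq
  rw [Real.norm_of_nonneg (by positivity)]
  have h3 : ‖∫ p, conj (f p) * Ψ (Fin.cons p q) ∂μ‖ ≤ ∫ p, ‖f p‖ * ‖Ψ (Fin.cons p q)‖ ∂μ := by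
    refine (norm_integral_le_integral_norm _).trans (le_of_eq ?_)
    congr 1
    funext p
    rw [norm_mul, RCLike.norm_conj]
  have h4 := integral_mul_norm_le_Lp_mul_Lq (μ := μ) Real.HolderConjugate.two_two
    (f := fun p => f p) (g := fun p => Ψ (Fin.cons p q))
    (by simpa using Lp.memLp f) (by simpa using hq)
  have h5 := pow_le_pow_left₀ (norm_nonneg _) (h3.trans h4) 2
  refine h5.trans (le_of_eq ?_)
  have e1 : (0 : ℝ) ≤ ∫ p, ‖f p‖ ^ (2 : ℝ) ∂μ := integral_nonneg fun _ => by positivity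
  have e2 : (0 : ℝ) ≤ ∫ p, ‖Ψ (Fin.cons p q)‖ ^ (2 : ℝ) ∂μ :=
    integral_nonneg fun _ => by positivity
  rw [mul_pow, ← Real.sqrt_eq_rpow, ← Real.sqrt_eq_rpow, Real.sq_sqrt e1, Real.sq_sqrt e2]
  simp only [Real.rpow_two, Function.comp_apply]

theorem annihFun_symm (μ : Measure α) [SigmaFinite μ] (f : Lp ℂ 2 μ) {k : ℕ}
    (Ψ : symmL2 μ (k + 1)) (σ : Equiv.Perm (Fin k)) :
    (fun q : Fin k → α => annihFun μ f Ψ.1 fun i => q (σ i))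
      =ᵐ[Measure.pi fun _ : Fin k => μ] annihFun μ f Ψ.1 := by
  have h := (measurePreserving_cons μ k).quasiMeasurePreserving.ae
    (Ψ.2 (Equiv.Perm.decomposeFin.symm (0, σ)))
  filter_upwards [Measure.ae_ae_of_ae_prod h] with q hq
  unfold annihFun
  congr 1
  refine integral_congr_ae ?_
  filter_upwards [hq] with p hp
  rw [← hp]
  congr 3
  funext i
  refine Fin.cases ?_ (fun j => ?_) i
  · simp
  · simp

/-- The annihilation operator as a map from the `(k+1)`-particle to the `k`-particle space. -/
def annihLevel (μ : Measure α) [SigmaFinite μ] (f : Lp ℂ 2 μ) (k : ℕ) :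
    symmL2 μ (k + 1) →ₗ[ℂ] symmL2 μ k where
  toFun Ψ := ⟨(annihFun_memLp μ f Ψ.1).toLp, by
    intro σ
    have h0 := (annihFun_memLp μ f Ψ.1).coeFn_toLp
    have h := (measurePreserving_relabel μ σ).quasiMeasurePreserving.ae h0
    filter_upwards [h0, h, annihFun_symm μ f Ψ σ] with q h1 h2 h3
    rw [h1, h2, h3]⟩
  map_add' Ψ Φ := by
    apply Subtype.ext
    change (annihFun_memLp μ f (Ψ.1 + Φ.1)).toLp = (annihFun_memLp μ f Ψ.1).toLp +
      (annihFun_memLp μ f Φ.1).toLp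
    rw [← MemLp.toLp_add, MemLp.toLp_eq_toLp_iff]
    have h := (measurePreserving_cons μ k).quasiMeasurePreserving.ae (Lp.coeFn_add Ψ.1 Φ.1)
    filter_upwards [Measure.ae_ae_of_ae_prod h, integrable_section μ f Ψ.1,
      integrable_section μ f Φ.1] with q h1 h2 h3
    rw [Pi.add_apply]
    unfold annihFun
    rw [← mul_add, ← integral_add h2 h3]
    congr 1
    refine integral_congr_ae ?_
    filter_upwards [h1] with p hp
    rw [hp, Pi.add_apply, mul_add]
  map_smul' c Ψ := by
    apply Subtype.ext
    change (annihFun_memLp μ f (c • Ψ.1)).toLp = c • (annihFun_memLp μ f Ψ.1).toLp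
    rw [← MemLp.toLp_const_smul, MemLp.toLp_eq_toLp_iff]
    have h := (measurePreserving_cons μ k).quasiMeasurePreserving.ae (Lp.coeFn_smul c Ψ.1)
    filter_upwards [Measure.ae_ae_of_ae_prod h] with q h1
    rw [Pi.smul_apply]
    unfold annihFun
    rw [smul_eq_mul, mul_left_comm, ← integral_const_mul c]
    congr 1
    refine integral_congr_ae ?_
    filter_upwards [h1] with p hp
    rw [hp, Pi.smul_apply, smul_eq_mul]
    ring

/-- The annihilation operator of `f ∈ L²(α, μ)`, antilinear in `f`, as an unbounded operator on the
Fock space,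
`(a(f)Ψ)_k(q₁, …, q_k) = √(k+1) ∫ conj (f p) Ψ_{k+1}(p, q₁, …, q_k) dμ(p)`,
on its maximal domain of all `Ψ` for which the right-hand sides form a vector of the Fock space. -/
def annihilation (μ : Measure α) [SigmaFinite μ] (f : Lp ℂ 2 μ) :
    BosonFock μ →ₗ.[ℂ] BosonFock μ where
  domain :=
    { carrier := {Ψ | Memℓp (fun k : ℕ => annihLevel μ f k (Ψ (k + 1))) 2}
      add_mem' := by
        intro Ψ Φ hΨ hΦ
        have h : Memℓp ((fun k : ℕ => annihLevel μ f k (Ψ (k + 1))) +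
          fun k : ℕ => annihLevel μ f k (Φ (k + 1))) 2 := Memℓp.add hΨ hΦ
        have e : (fun k : ℕ => annihLevel μ f k ((Ψ + Φ) (k + 1))) =
            (fun k : ℕ => annihLevel μ f k (Ψ (k + 1))) +
              fun k : ℕ => annihLevel μ f k (Φ (k + 1)) := by
          funext k
          exact map_add _ _ _
        change Memℓp (fun k : ℕ => annihLevel μ f k ((Ψ + Φ) (k + 1))) 2
        rw [e]
        exact h
      zero_mem' := by
        have h : Memℓp (0 : ∀ k : ℕ, symmL2 μ k) 2 := zero_memℓp
        have e : (fun k : ℕ => annihLevel μ f k ((0 : BosonFock μ) (k + 1))) = 0 := by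
          funext k
          exact map_zero _
        change Memℓp (fun k : ℕ => annihLevel μ f k ((0 : BosonFock μ) (k + 1))) 2
        rw [e]
        exact h
      smul_mem' := by
        intro c Ψ hΨ
        have h : Memℓp (c • fun k : ℕ => annihLevel μ f k (Ψ (k + 1))) 2 :=
          Memℓp.const_smul hΨ c
        have e : (fun k : ℕ => annihLevel μ f k ((c • Ψ) (k + 1))) =
            c • fun k : ℕ => annihLevel μ f k (Ψ (k + 1)) := by
          funext k
          exact map_smul (annihLevel μ f k) c (Ψ (k + 1))
        change Memℓp (fun k : ℕ => annihLevel μ f k ((c • Ψ) (k + 1))) 2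
        rw [e]
        exact h }
  toFun :=
    { toFun := fun Ψ => ⟨fun k : ℕ => annihLevel μ f k (Ψ.1 (k + 1)), Ψ.2⟩
      map_add' := by
        intro Ψ Φ
        ext1
        funext k
        exact map_add (annihLevel μ f k) _ _
      map_smul' := by
        intro c Ψ
        ext1
        funext k
        exact map_smul (annihLevel μ f k) _ _ }

theorem phase_memLp {μ : Measure α} {θ : α → ℝ} (hθ : Measurable θ) (Ψ : Lp ℂ 2 μ) :
    MemLp (fun p => Complex.exp (Complex.I * (θ p : ℂ)) * Ψ p) 2 μ := by
  have hm : Measurable fun p => Complex.exp (Complex.I * (θ p : ℂ)) := by fun_prop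
  refine (Lp.memLp Ψ).of_le (hm.aestronglyMeasurable.mul (Lp.memLp Ψ).1) ?_
  refine Eventually.of_forall fun p => ?_
  rw [norm_mul, mul_comm Complex.I, Complex.norm_exp_ofReal_mul_I, one_mul]

/-- Multiplication by the phase `exp (i θ)` on `L²`. -/
def phaseLp (μ : Measure α) (θ : α → ℝ) (hθ : Measurable θ) : Lp ℂ 2 μ →ₗᵢ[ℂ] Lp ℂ 2 μ where
  toFun Ψ := (phase_memLp hθ Ψ).toLp
  map_add' Ψ Φ := by
    rw [← MemLp.toLp_add, MemLp.toLp_eq_toLp_iff]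
    filter_upwards [Lp.coeFn_add Ψ Φ] with p hp
    rw [hp, Pi.add_apply, Pi.add_apply, mul_add]
  map_smul' c Ψ := by
    rw [RingHom.id_apply, ← MemLp.toLp_const_smul, MemLp.toLp_eq_toLp_iff]
    filter_upwards [Lp.coeFn_smul c Ψ] with p hp
    rw [hp, Pi.smul_apply, Pi.smul_apply, smul_eq_mul, smul_eq_mul]
    ring
  norm_map' Ψ := by
    change ‖(phase_memLp hθ Ψ).toLp‖ = ‖Ψ‖
    rw [Lp.norm_toLp, Lp.norm_def]
    congr 1
    refine eLpNorm_congr_norm_ae (Eventually.of_forall fun p => ?_)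
    rw [norm_mul, mul_comm Complex.I, Complex.norm_exp_ofReal_mul_I, one_mul]

theorem phaseLp_neg (μ : Measure α) (θ η : α → ℝ) (hθ : Measurable θ) (hη : Measurable η)
    (h : ∀ p, θ p + η p = 0) (Ψ : Lp ℂ 2 μ) : phaseLp μ θ hθ (phaseLp μ η hη Ψ) = Ψ := by
  apply Lp.ext
  filter_upwards [(phase_memLp hθ (phaseLp μ η hη Ψ)).coeFn_toLp,
    (phase_memLp hη Ψ).coeFn_toLp] with p h1 h2
  change ((phase_memLp hθ (phaseLp μ η hη Ψ)).toLp : Lp ℂ 2 μ) p = Ψ p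
  rw [h1]
  change _ * ((phase_memLp hη Ψ).toLp : Lp ℂ 2 μ) p = Ψ p
  rw [h2, ← mul_assoc, ← Complex.exp_add, ← mul_add, ← Complex.ofReal_add, h]
  simp

theorem measurable_sum_phase {θ : α → ℝ} (hθ : Measurable θ) (k : ℕ) :
    Measurable fun q : Fin k → α => ∑ j, θ (q j) :=
  Finset.measurable_fun_sum _ fun j _ => hθ.comp (measurable_pi_apply j)

/-- Multiplication by `exp (i ∑ⱼ θ(qⱼ))` on the `k`-particle space. -/
def phaseLevel (μ : Measure α) [SigmaFinite μ] (θ : α → ℝ) (hθ : Measurable θ) (k : ℕ) :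
    symmL2 μ k →ₗᵢ[ℂ] symmL2 μ k where
  toFun Ψ := ⟨phaseLp _ (fun q : Fin k → α => ∑ j, θ (q j)) (measurable_sum_phase hθ k) Ψ.1, by
    intro σ
    have h0 := (phase_memLp (measurable_sum_phase hθ k) Ψ.1).coeFn_toLp
    have h := (measurePreserving_relabel μ σ).quasiMeasurePreserving.ae h0
    filter_upwards [h0, h, Ψ.2 σ] with q h1 h2 h3
    refine h2.trans (Eq.trans ?_ h1.symm)
    rw [h3, Equiv.sum_comp σ fun j => θ (q j)]⟩
  map_add' Ψ Φ := Subtype.ext (map_add (phaseLp _ _ (measurable_sum_phase hθ k)) Ψ.1 Φ.1)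
  map_smul' c Ψ := Subtype.ext (map_smul (phaseLp _ _ (measurable_sum_phase hθ k)) c Ψ.1)
  norm_map' Ψ := (phaseLp _ _ (measurable_sum_phase hθ k)).norm_map Ψ.1

theorem phaseLevel_neg (μ : Measure α) [SigmaFinite μ] (θ η : α → ℝ) (hθ : Measurable θ)
    (hη : Measurable η) (h : ∀ p, θ p + η p = 0) (k : ℕ) (Ψ : symmL2 μ k) :
    phaseLevel μ θ hθ k (phaseLevel μ η hη k Ψ) = Ψ :=
  Subtype.ext (phaseLp_neg _ _ _ _ _
    (fun q => by rw [← Finset.sum_add_distrib]; simp [h]) Ψ.1)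

theorem phaseLevel_memℓp (μ : Measure α) [SigmaFinite μ] (θ : α → ℝ) (hθ : Measurable θ)
    (Ψ : BosonFock μ) : Memℓp (fun k : ℕ => phaseLevel μ θ hθ k (Ψ k)) 2 := by
  rw [← memℓp_norm_iff]
  simp only [LinearIsometry.norm_map]
  exact memℓp_norm_iff.2 (lp.memℓp Ψ)

/-- The second quantization of the one-particle unitary "multiplication by `exp (i θ)`": on the
`k`-particle space it multiplies by `exp (i ∑ⱼ θ(qⱼ))`. -/
def fockPhase (μ : Measure α) [SigmaFinite μ] (θ : α → ℝ) (hθ : Measurable θ) :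
    BosonFock μ ≃ₗᵢ[ℂ] BosonFock μ where
  toFun Ψ := ⟨fun k : ℕ => phaseLevel μ θ hθ k (Ψ k), phaseLevel_memℓp μ θ hθ Ψ⟩
  invFun Ψ := ⟨fun k : ℕ => phaseLevel μ (fun p => -θ p) hθ.neg k (Ψ k),
    phaseLevel_memℓp μ _ hθ.neg Ψ⟩
  left_inv Ψ := by
    ext1
    funext k
    exact phaseLevel_neg μ _ _ _ _ (fun p => by simp) k (Ψ k)
  right_inv Ψ := by
    ext1
    funext k
    exact phaseLevel_neg μ _ _ _ _ (fun p => by simp) k (Ψ k)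
  map_add' Ψ Φ := by
    ext1
    funext k
    exact map_add (phaseLevel μ θ hθ k) _ _
  map_smul' c Ψ := by
    ext1
    funext k
    exact map_smul (phaseLevel μ θ hθ k) _ _
  norm_map' Ψ := by
    rw [lp.norm_eq_tsum_rpow (by norm_num), lp.norm_eq_tsum_rpow (by norm_num)]
    change (∑' k : ℕ, ‖phaseLevel μ θ hθ k (Ψ k)‖ ^ _) ^ _ = _
    simp only [LinearIsometry.norm_map]

/-- The conjugate `U A U⁻¹` of an unbounded operator `A` by a unitary `U`, with domain
`U (dom A)`. -/
def conjOp {H : Type*} [NormedAddCommGroup H] [InnerProductSpace ℂ H]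
    (U : H ≃ₗᵢ[ℂ] H) (A : H →ₗ.[ℂ] H) : H →ₗ.[ℂ] H where
  domain := A.domain.comap (U.symm.toLinearEquiv : H →ₗ[ℂ] H)
  toFun :=
    { toFun := fun Ψ => U (A ⟨U.symm Ψ.1, Ψ.2⟩)
      map_add' := by
        intro Ψ Φ
        rw [← map_add, ← LinearPMap.map_add]
        congr 2
        exact Subtype.ext (map_add U.symm Ψ.1 Φ.1)
      map_smul' := by
        intro c Ψ
        rw [RingHom.id_apply, ← map_smul, ← LinearPMap.map_smul]
        congr 2
        exact Subtype.ext (map_smul U.symm c Ψ.1) }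

end FockSpace

section FreeField

/-- Three-dimensional Euclidean space, used both for momenta `𝐩` and for positions `𝐱`. -/
abbrev Space3 : Type := EuclideanSpace ℝ (Fin 3)

/-- The relativistic energy `ω_𝐩 = √(|𝐩|² + m²)`. -/
def energy (m : ℝ) (p : Space3) : ℝ := Real.sqrt (‖p‖ ^ 2 + m ^ 2)

theorem continuous_energy (m : ℝ) : Continuous (energy m) := by
  unfold energy
  fun_prop

/-- The Lorentz invariant measure `d³𝐩 / (2 ω_𝐩)`. -/
def massShell (m : ℝ) : Measure Space3 :=
  volume.withDensity fun p => ENNReal.ofReal (1 / (2 * energy m p))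

instance (m : ℝ) : SigmaFinite (massShell m) := by
  unfold massShell
  exact SigmaFinite.withDensity_ofReal _

/-- The Fock space of the free scalar field of mass `m`. -/
abbrev ScalarFock (m : ℝ) : Type := BosonFock (massShell m)

/-- The unitary operator `U(y, 𝕀)` of the translation by `y = (t, 𝐲)`. On the `k`-particle space
it multiplies by `exp (i ∑ⱼ pⱼ·y)`, with `p·y = ω_𝐩 t - 𝐩·𝐲` the Minkowski product. -/
def translationU (m t : ℝ) (y : Space3) : ScalarFock m ≃ₗᵢ[ℂ] ScalarFock m :=
  fockPhase (massShell m) (fun p => energy m p * t - inner ℝ p y)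
    (Continuous.measurable
      (((continuous_energy m).mul continuous_const).sub (continuous_id.inner continuous_const)))

/-- The function `F(𝐩) = (2π)^{-3/2} ∫ f(𝐱) e^{i 𝐩·𝐱} d³𝐱`, for which
`∫ f(𝐱) ã(𝐱) d³𝐱 = ∫ F(𝐩) a(𝐩) d³𝐩`. -/
def smearFourier (f : 𝓢(Space3, ℂ)) (p : Space3) : ℂ :=
  (((2 * Real.pi) ^ (-(3 / 2) : ℝ) : ℝ) : ℂ) *
    ∫ x : Space3, f x * Complex.exp (Complex.I * ((inner ℝ p x : ℝ) : ℂ))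

theorem smearFourier_memLp (f : 𝓢(Space3, ℂ)) : MemLp (smearFourier f) 2 volume := by
  have hπ : (2 * Real.pi)⁻¹ ≠ 0 := by positivity
  let e : Space3 ≃L[ℝ] Space3 := ContinuousLinearEquiv.smulLeft (Units.mk0 _ hπ)
  have h := (SchwartzMap.compCLMOfContinuousLinearEquiv ℂ e (𝓕⁻ f)).memLp 2 volume
  refine MemLp.const_mul (h.ae_eq (Eventually.of_forall fun p => ?_)) _
  simp only [SchwartzMap.compCLMOfContinuousLinearEquiv_apply, Function.comp_apply]
  have he : e p = (2 * Real.pi)⁻¹ • p := rfl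
  rw [he, SchwartzMap.fourierInv_coe, Real.fourierInv_eq']
  refine integral_congr_ae (Eventually.of_forall fun x => ?_)
  simp only [smul_eq_mul]
  rw [mul_comm, inner_smul_right, real_inner_comm]
  congr 2
  rw [← mul_assoc, mul_inv_cancel₀ (by positivity), one_mul, mul_comm]

theorem smear_memLp (m : ℝ) (hm : 0 < m) (f : 𝓢(Space3, ℂ)) :
    MemLp (fun p => conj ((Real.sqrt (2 * energy m p) : ℂ) * smearFourier f p)) 2
      (massShell m) := by
  have hpos : ∀ p, 0 < energy m p := fun p => Real.sqrt_pos.2 (by positivity)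
  have hF := smearFourier_memLp f
  have hc : Continuous fun p => (Real.sqrt (2 * energy m p) : ℂ) := by
    have := continuous_energy m
    fun_prop
  have hme : AEStronglyMeasurable
      (fun p => conj ((Real.sqrt (2 * energy m p) : ℂ) * smearFourier f p)) volume :=
    (hc.aestronglyMeasurable.mul hF.1).star
  have hac : massShell m ≪ volume := withDensity_absolutelyContinuous _ _
  rw [memLp_two_iff_integrable_sq_norm (hme.mono_ac hac)]
  have hd : Measurable fun p => ENNReal.ofReal (1 / (2 * energy m p)) := by
    have := (continuous_energy m).measurable
    fun_prop
  unfold massShell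
  rw [integrable_withDensity_iff_integrable_smul' hd
    (Eventually.of_forall fun _ => ENNReal.ofReal_lt_top)]
  refine ((memLp_two_iff_integrable_sq_norm hF.1).1 hF).congr
    (Eventually.of_forall fun p => ?_)
  have h2 : (0 : ℝ) < 2 * energy m p := by linarith [hpos p]
  simp only [smul_eq_mul]
  rw [ENNReal.toReal_ofReal (by positivity), RCLike.norm_conj, norm_mul, Complex.norm_real,
    Real.norm_of_nonneg (Real.sqrt_nonneg _), mul_pow, Real.sq_sqrt h2.le]
  rw [← mul_assoc, one_div, inv_mul_cancel₀ h2.ne', one_mul]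

/-- The coordinate space annihilation operator
`ã(𝐱) = (2π)^{-3/2} ∫ e^{i 𝐩·𝐱} a(𝐩) d³𝐩`, `a(𝐩) = a_c(𝐩) / √(2 ω_𝐩)`, as an operator valued
distribution: `coordAnnihilation m hm f` is `ã(f) = ∫ f(𝐱) ã(𝐱) d³𝐱`. Since
`a_c(h) = ∫ conj (h(𝐩)) a_c(𝐩) d³𝐩 / (2 ω_𝐩)`, this is `a_c(h)` with
`h(𝐩) = conj (√(2 ω_𝐩) F(𝐩))`, `F = smearFourier f`. -/
def coordAnnihilation (m : ℝ) (hm : 0 < m) (f : 𝓢(Space3, ℂ)) :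
    ScalarFock m →ₗ.[ℂ] ScalarFock m :=
  annihilation (massShell m) (smear_memLp m hm f).toLp

end FreeField

section Kernel

/-- The integral `∫_0^∞ e^{-z cosh u} cosh (ν u) du`, which is `K_ν(z)` for `Re z > 0`. -/
def besselKIntegral (ν : ℝ) (z : ℂ) : ℂ :=
  ∫ u in Set.Ioi (0 : ℝ), Complex.exp (-z * Real.cosh u) * Real.cosh (ν * u)

/-- The modified Bessel function of the second kind `K_ν(z)` (Macdonald function) for
`Re z ≥ 0`, `z ≠ 0`: given by the integral for `Re z > 0`, and by continuity on the imaginary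
axis. -/
def besselK (ν : ℝ) (z : ℂ) : ℂ :=
  if 0 < z.re then besselKIntegral ν z
  else limUnder (𝓝[{w : ℂ | 0 < w.re}] z) (besselKIntegral ν)

/-- The time translation kernel `(i ζ / 2π²) · m² K₂(m √(|𝐰|² - ζ²)) / (|𝐰|² - ζ²)` at complex
time `ζ`, with the principal square root. -/
def timeKernel (m : ℝ) (ζ : ℂ) (w : Space3) : ℂ :=
  Complex.I * ζ / (2 * (Real.pi : ℂ) ^ 2) *
    ((m : ℂ) ^ 2 * besselK 2 (m * ((‖w‖ : ℂ) ^ 2 - ζ ^ 2) ^ (1 / 2 : ℂ)) /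
      ((‖w‖ : ℂ) ^ 2 - ζ ^ 2))

/-- `√(|𝐰|² - t²)` for real time `t`: the nonnegative root for `|𝐰| ≥ |t|`, and
`i sgn(t) √(t² - |𝐰|²)` for `|𝐰| < |t|`. -/
def lightConeRoot (t : ℝ) (w : Space3) : ℂ :=
  if |t| ≤ ‖w‖ then (Real.sqrt (‖w‖ ^ 2 - t ^ 2) : ℂ)
  else Complex.I * (SignType.sign t : ℝ) * (Real.sqrt (t ^ 2 - ‖w‖ ^ 2) : ℂ)

/-- The time translation kernel `(i t / 2π²) · m² K₂(m √(|𝐰|² - t²)) / (|𝐰|² - t²)` at real time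
`t`, away from the light cone `|𝐰| = |t|`. -/
def realTimeKernel (m t : ℝ) (w : Space3) : ℂ :=
  Complex.I * t / (2 * (Real.pi : ℂ) ^ 2) *
    ((m : ℂ) ^ 2 * besselK 2 (m * lightConeRoot t w) / ((‖w‖ : ℂ) ^ 2 - (t : ℂ) ^ 2))

/-- `g` is the test function `𝐳 ↦ ∫ f(𝐱) k(𝐱 + 𝐲 - 𝐳) d³𝐱 = k(f(· + 𝐳 - 𝐲))`. For an operator
valued distribution `T`, the distribution `𝐱 ↦ (k ∗ T)(𝐱 + 𝐲) = ∫ k(𝐱 + 𝐲 - 𝐳) T(𝐳) d³𝐳` smeared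
with `f` is `T(g)`. -/
def IsConvolutionTest (k : 𝓢'(Space3, ℂ)) (y : Space3) (f g : 𝓢(Space3, ℂ)) : Prop :=
  ∀ z : Space3, g z = k (SchwartzMap.compSubConstCLM ℂ (y - z) f)

end Kernel

end

/-!
In momentum space, conjugation by the translation multiplies the smearing function of `ã` by
`exp (-i (ω y⁰ - 𝐩 · 𝐲))`, so `k_t` is the inverse Fourier transform of `exp (-i t ω)`, and what
has to be computed is the inverse Fourier transform of `exp (-i ζ ω)` for `Im ζ < 0`. For
`ζ = -i s`, the subordination formula (the closed form of `K_{1/2}`) writes `exp (-s ω)` as a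
superposition of Gaussians in the momentum; transforming these one by one leaves an integral of the
same type, now representing `K₂ (m √(|𝐰|² + s²))`. Both sides are holomorphic in `ζ`, so the
identity extends to the lower half plane.

The boundary value `ζ → t - i0` of the distributions exists because `|exp (-i ζ ω)| ≤ 1` there. Off
the light cone the root `√(|𝐰|² - ζ²)` tends to a nonzero point of the closed right half plane, up
to which `K₂` extends continuously: moving the contour `[0, ∞)` to `[0, ∞) ∓ iπ/2` turns the
defining integral into one that converges on the imaginary axis as well.
-/

section FockConjugation

variable {α : Type*} [MeasurableSpace α] (μ : Measure α) [SigmaFinite μ] {θ : α → ℝ}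

theorem coeFn_phaseLevel (hθ : Measurable θ) (k : ℕ) (Ψ : symmL2 μ k) :
    (phaseLevel μ θ hθ k Ψ).1 =ᵐ[Measure.pi fun _ : Fin k => μ]
      fun q => Complex.exp (Complex.I * ((∑ j, θ (q j) : ℝ) : ℂ)) * Ψ.1 q :=
  (phase_memLp (measurable_sum_phase hθ k) Ψ.1).coeFn_toLp

theorem coeFn_annihLevel (f : Lp ℂ 2 μ) (k : ℕ) (Ψ : symmL2 μ (k + 1)) :
    (annihLevel μ f k Ψ).1 =ᵐ[Measure.pi fun _ : Fin k => μ] annihFun μ f Ψ.1 :=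
  (annihFun_memLp μ f Ψ.1).coeFn_toLp

theorem annihFun_phaseLevel_neg (hθ : Measurable θ) {f g : Lp ℂ 2 μ}
    (hg : g =ᵐ[μ] fun p => Complex.exp (Complex.I * (θ p : ℂ)) * f p) (k : ℕ)
    (Ψ : symmL2 μ (k + 1)) :
    annihFun μ f (phaseLevel μ (fun p => -θ p) hθ.neg (k + 1) Ψ).1
      =ᵐ[Measure.pi fun _ : Fin k => μ]
        fun q => Complex.exp (-(Complex.I * ((∑ j, θ (q j) : ℝ) : ℂ))) * annihFun μ g Ψ.1 q := by
  have hΨ := (measurePreserving_cons μ k).quasiMeasurePreserving.ae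
    (coeFn_phaseLevel μ (θ := fun p => -θ p) hθ.neg (k + 1) Ψ)
  filter_upwards [Measure.ae_ae_of_ae_prod hΨ] with q hq
  simp only [annihFun]
  rw [mul_left_comm, ← integral_const_mul (Complex.exp _)]
  congr 1
  refine integral_congr_ae ?_
  filter_upwards [hq, hg] with p hp hgp
  have hphase : Complex.exp (Complex.I *
      ((∑ j, -θ ((Fin.cons p q : Fin (k + 1) → α) j) : ℝ) : ℂ)) =
      Complex.exp (-(Complex.I * ((∑ j, θ (q j) : ℝ) : ℂ))) *
        Complex.exp (-(Complex.I * (θ p : ℂ))) := by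
    rw [Fin.sum_univ_succ, ← Complex.exp_add]
    simp only [Fin.cons_zero, Fin.cons_succ, Finset.sum_neg_distrib]
    push_cast
    ring_nf
  have hconj : conj (g p) = Complex.exp (-(Complex.I * (θ p : ℂ))) * conj (f p) := by
    rw [hgp, map_mul, ← Complex.exp_conj, map_mul, Complex.conj_I, Complex.conj_ofReal, neg_mul]
  rw [hp, hphase, hconj]
  ring

theorem phaseLevel_annihLevel_phaseLevel_neg (hθ : Measurable θ) {f g : Lp ℂ 2 μ}
    (hg : g =ᵐ[μ] fun p => Complex.exp (Complex.I * (θ p : ℂ)) * f p) (k : ℕ)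
    (Ψ : symmL2 μ (k + 1)) :
    phaseLevel μ θ hθ k (annihLevel μ f k (phaseLevel μ (fun p => -θ p) hθ.neg (k + 1) Ψ)) =
      annihLevel μ g k Ψ := by
  refine Subtype.ext (Lp.ext ?_)
  filter_upwards [coeFn_phaseLevel μ hθ k _, coeFn_annihLevel μ f k _,
    coeFn_annihLevel μ g k Ψ, annihFun_phaseLevel_neg μ hθ hg k Ψ] with q hphase hf hg hann
  rw [hphase, hf, hg, hann, ← mul_assoc, ← Complex.exp_add, add_neg_cancel, Complex.exp_zero,
    one_mul]

theorem conjOp_fockPhase_annihilation (hθ : Measurable θ) {f g : Lp ℂ 2 μ}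
    (hg : g =ᵐ[μ] fun p => Complex.exp (Complex.I * (θ p : ℂ)) * f p) :
    conjOp (fockPhase μ θ hθ) (annihilation μ f) = annihilation μ g := by
  have hlevel := phaseLevel_annihLevel_phaseLevel_neg μ hθ hg
  have hdomain (Ψ : BosonFock μ) : Memℓp (fun k : ℕ => annihLevel μ f k
      (phaseLevel μ (fun p => -θ p) hθ.neg (k + 1) (Ψ (k + 1)))) 2 ↔
      Memℓp (fun k : ℕ => annihLevel μ g k (Ψ (k + 1))) 2 := by
    rw [← memℓp_norm_iff, ← memℓp_norm_iff (f := fun k : ℕ => annihLevel μ g k (Ψ (k + 1)))]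
    simp only [← hlevel, LinearIsometry.norm_map]
  refine LinearPMap.ext (Submodule.ext hdomain) fun Ψ _ _ => ?_
  ext1
  exact funext fun k => hlevel k (Ψ (k + 1))

end FockConjugation

section Fourier

variable {V E : Type*} [NormedAddCommGroup V] [InnerProductSpace ℝ V] [FiniteDimensional ℝ V]
  [MeasurableSpace V] [BorelSpace V] [NormedAddCommGroup E] [NormedSpace ℂ E]

theorem fourierInv_compSubConst (f : 𝓢(V, E)) (a ξ : V) :
    𝓕⁻ (SchwartzMap.compSubConstCLM ℂ a f) ξ =
      Complex.exp (2 * Real.pi * Complex.I * (inner ℝ a ξ : ℝ)) • 𝓕⁻ f ξ := by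
  rw [SchwartzMap.fourierInv_coe, SchwartzMap.fourierInv_coe, Real.fourierInv_eq',
    Real.fourierInv_eq', ← integral_smul, ← integral_add_right_eq_self (fun v : V => _) a]
  congr 1
  funext v
  rw [SchwartzMap.compSubConstCLM_apply, add_sub_cancel_right, smul_smul, ← Complex.exp_add,
    inner_add_left]
  push_cast
  ring_nf

end Fourier

section Momentum

theorem iteratedDeriv_cexp_const_mul_ofReal (c : ℂ) (n : ℕ) :
    iteratedDeriv n (fun u : ℝ => Complex.exp (c * u)) =
      fun u : ℝ => c ^ n * Complex.exp (c * u) := by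
  induction n with
  | zero => simp
  | succ n ih =>
    have hderiv (u : ℝ) : HasDerivAt (fun u : ℝ => c * (u : ℂ)) c u := by
      simpa using (Complex.ofRealCLM.hasDerivAt (x := u)).const_mul c
    rw [iteratedDeriv_succ, ih]
    funext u
    rw [((hderiv u).cexp.const_mul _).deriv]
    ring

theorem hasTemperateGrowth_cexp_mul_I (t : ℝ) :
    Function.HasTemperateGrowth fun u : ℝ => Complex.exp (t * Complex.I * u) := by
  refine ⟨(contDiff_const.mul Complex.ofRealCLM.contDiff).cexp, fun n => ⟨0, |t| ^ n, fun u => ?_⟩⟩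
  have hphase : (t : ℂ) * Complex.I * u = ((t * u : ℝ) : ℂ) * Complex.I := by
    push_cast
    ring
  rw [norm_iteratedFDeriv_eq_norm_iteratedDeriv, iteratedDeriv_cexp_const_mul_ofReal, norm_mul,
    hphase, Complex.norm_exp_ofReal_mul_I]
  simp

theorem energy_pos {m : ℝ} (hm : 0 < m) (p : Space3) : 0 < energy m p :=
  Real.sqrt_pos.2 (by positivity)

theorem norm_le_energy (m : ℝ) (p : Space3) : ‖p‖ ≤ energy m p :=
  Real.le_sqrt_of_sq_le (le_add_of_nonneg_right (sq_nonneg m))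

theorem energy_sq (m : ℝ) (p : Space3) : energy m p ^ 2 = ‖p‖ ^ 2 + m ^ 2 :=
  Real.sq_sqrt (by positivity)

theorem hasTemperateGrowth_energy {m : ℝ} (hm : 0 < m) :
    Function.HasTemperateGrowth (energy m) := by
  have hgrowth : Function.HasTemperateGrowth
      fun p : Space3 => m * (1 + ‖m⁻¹ • p‖ ^ 2) ^ (1 / 2 : ℝ) :=
    (Function.HasTemperateGrowth.const m).mul
      ((Function.hasTemperateGrowth_one_add_norm_sq_rpow Space3 (1 / 2)).comp
        (m⁻¹ • ContinuousLinearMap.id ℝ Space3).hasTemperateGrowth)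
  convert hgrowth using 2 with p
  rw [← Real.sqrt_eq_rpow, energy, Real.sqrt_eq_iff_mul_self_eq (by positivity) (by positivity),
    mul_mul_mul_comm, Real.mul_self_sqrt (by positivity), norm_smul,
    Real.norm_of_nonneg (by positivity)]
  field_simp
  ring

/-- The function `ξ ↦ exp (-i ζ ω_{2πξ})`, the Fourier transform (with Mathlib's normalization,
hence the argument `2πξ`) of the translation kernel `k_ζ` at complex time `ζ`. -/
noncomputable def timePhase (m : ℝ) (ζ : ℂ) (ξ : Space3) : ℂ :=
  Complex.exp (-(Complex.I * ζ) * energy m ((2 * Real.pi) • ξ))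

@[simp]
theorem timePhase_zero (m : ℝ) : timePhase m 0 = fun _ => 1 := by
  funext ξ
  simp [timePhase]

theorem continuous_timePhase (m : ℝ) (ζ : ℂ) : Continuous (timePhase m ζ) := by
  have := continuous_energy m
  unfold timePhase
  fun_prop

theorem norm_timePhase (m : ℝ) (ζ : ℂ) (ξ : Space3) :
    ‖timePhase m ζ ξ‖ = Real.exp (ζ.im * energy m ((2 * Real.pi) • ξ)) := by
  simp [timePhase, Complex.norm_exp]

theorem hasTemperateGrowth_timePhase {m : ℝ} (hm : 0 < m) (t : ℝ) :
    Function.HasTemperateGrowth (timePhase m t) := by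
  have hgrowth := (hasTemperateGrowth_cexp_mul_I (-t)).comp ((hasTemperateGrowth_energy hm).comp
    ((2 * Real.pi) • ContinuousLinearMap.id ℝ Space3).hasTemperateGrowth)
  convert hgrowth using 1
  funext ξ
  simp [timePhase, mul_comm]

/-- The time translation kernel `k_t` as a tempered distribution: the inverse Fourier transform of
`exp (-i t ω)`. -/
noncomputable def timeDistribution {m : ℝ} (hm : 0 < m) (t : ℝ) : 𝓢'(Space3, ℂ) :=
  𝓕⁻ ((hasTemperateGrowth_timePhase hm t).toTemperedDistribution volume)

theorem timeDistribution_apply {m : ℝ} (hm : 0 < m) (t : ℝ) (f : 𝓢(Space3, ℂ)) :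
    timeDistribution hm t f = ∫ ξ, timePhase m t ξ * 𝓕⁻ f ξ := by
  rw [timeDistribution, TemperedDistribution.fourierInv_apply]
  refine (Function.HasTemperateGrowth.toTemperedDistribution_apply volume
    (hasTemperateGrowth_timePhase hm t) (𝓕⁻ f)).trans ?_
  simp only [smul_eq_mul, mul_comm]

/-- The test function `g` with `U(y, 𝕀) ã(f) U(y, 𝕀)⁻¹ = ã(g)` for the translation by `(t, y)`:
shift `f` by `y` and apply the Fourier multiplier `exp (-i t ω)`. -/
noncomputable def translatedTest (m t : ℝ) (y : Space3) (f : 𝓢(Space3, ℂ)) : 𝓢(Space3, ℂ) :=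
  𝓕 (SchwartzMap.smulLeftCLM ℂ (timePhase m t) (𝓕⁻ (SchwartzMap.compSubConstCLM ℂ y f)))

theorem translatedTest_zero (m : ℝ) (y : Space3) (f : 𝓢(Space3, ℂ)) :
    translatedTest m 0 y f = SchwartzMap.compSubConstCLM ℂ y f := by
  rw [translatedTest, Complex.ofReal_zero, timePhase_zero, SchwartzMap.smulLeftCLM_const, one_smul,
    ContinuousLinearMap.id_apply, FourierTransform.fourier_fourierInv_eq]

theorem isConvolutionTest_translatedTest {m : ℝ} (hm : 0 < m) (t : ℝ) (y : Space3)
    (f : 𝓢(Space3, ℂ)) :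
    IsConvolutionTest (timeDistribution hm t) y f (translatedTest m t y f) := by
  intro z
  rw [timeDistribution_apply, translatedTest, SchwartzMap.fourier_coe, Real.fourier_eq']
  congr 1
  funext ξ
  rw [SchwartzMap.smulLeftCLM_apply_apply (hasTemperateGrowth_timePhase hm t),
    fourierInv_compSubConst, fourierInv_compSubConst, smul_comm, smul_smul (Complex.exp _),
    ← Complex.exp_add, inner_sub_left, real_inner_comm z ξ, smul_eq_mul]
  push_cast
  ring_nf

theorem smearFourier_eq (f : 𝓢(Space3, ℂ)) (p : Space3) :
    smearFourier f p = (((2 * Real.pi) ^ (-(3 / 2) : ℝ) : ℝ) : ℂ) *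
      𝓕⁻ f ((2 * Real.pi)⁻¹ • p) := by
  rw [smearFourier, SchwartzMap.fourierInv_coe, Real.fourierInv_eq']
  congr 2
  funext x
  rw [inner_smul_right, mul_inv_cancel_left₀ (by positivity), real_inner_comm, smul_eq_mul,
    mul_comm, mul_comm Complex.I]

theorem smearFourier_translatedTest {m : ℝ} (hm : 0 < m) (t : ℝ) (y : Space3)
    (f : 𝓢(Space3, ℂ)) (p : Space3) :
    smearFourier (translatedTest m t y f) p =
      Complex.exp (-(Complex.I * ((energy m p * t - inner ℝ p y : ℝ) : ℂ))) *
        smearFourier f p := by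
  have hphase : timePhase m t ((2 * Real.pi)⁻¹ • p) *
      Complex.exp (2 * Real.pi * Complex.I * (inner ℝ y ((2 * Real.pi)⁻¹ • p) : ℝ)) =
      Complex.exp (-(Complex.I * ((energy m p * t - inner ℝ p y : ℝ) : ℂ))) := by
    have hpi : (Real.pi : ℂ) ≠ 0 := by exact_mod_cast Real.pi_ne_zero
    rw [timePhase, smul_inv_smul₀ (by positivity), ← Complex.exp_add, inner_smul_right,
      real_inner_comm]
    push_cast
    field_simp
    ring_nf
  rw [smearFourier_eq, smearFourier_eq, translatedTest, FourierTransform.fourierInv_fourier_eq,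
    SchwartzMap.smulLeftCLM_apply_apply (hasTemperateGrowth_timePhase hm t),
    fourierInv_compSubConst, smul_smul, hphase, smul_eq_mul, mul_left_comm]

theorem conjOp_translationU_coordAnnihilation {m : ℝ} (hm : 0 < m) (t : ℝ) (y : Space3)
    (f : 𝓢(Space3, ℂ)) :
    conjOp (translationU m t y) (coordAnnihilation m hm f) =
      coordAnnihilation m hm (translatedTest m t y f) := by
  refine conjOp_fockPhase_annihilation _ _ ?_
  filter_upwards [(smear_memLp m hm f).coeFn_toLp,
    (smear_memLp m hm (translatedTest m t y f)).coeFn_toLp] with p hf hg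
  rw [hf, hg, smearFourier_translatedTest hm, mul_left_comm, map_mul, ← Complex.exp_conj, map_neg,
    map_mul, Complex.conj_I, Complex.conj_ofReal, neg_mul, neg_neg]

end Momentum

section Integrals

theorem integrable_exp_neg_mul_norm {E : Type*} [NormedAddCommGroup E] [NormedSpace ℝ E]
    [FiniteDimensional ℝ E] [MeasurableSpace E] [BorelSpace E] (μ : Measure E)
    [μ.IsAddHaarMeasure] {b : ℝ} (hb : 0 < b) :
    Integrable (fun x : E => Real.exp (-b * ‖x‖)) μ := by
  set n := Module.finrank ℝ E + 1
  have hpow : Integrable (fun x : E => (1 + ‖x‖) ^ (-(n : ℝ))) μ :=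
    integrable_one_add_norm (by simp [n])
  refine (hpow.const_mul (Real.exp b * n.factorial / b ^ n)).mono'
    (Continuous.aestronglyMeasurable (by fun_prop)) (Eventually.of_forall fun x => ?_)
  have hexp := Real.pow_div_factorial_le_exp (b * (1 + ‖x‖)) (by positivity) n
  rw [Real.norm_of_nonneg (Real.exp_pos _).le, Real.rpow_neg (by positivity), Real.rpow_natCast]
  calc Real.exp (-b * ‖x‖) = Real.exp b * (Real.exp (b * (1 + ‖x‖)))⁻¹ := by
        rw [← Real.exp_neg, ← Real.exp_add]
        ring_nf
    _ ≤ Real.exp b * ((b * (1 + ‖x‖)) ^ n / n.factorial)⁻¹ := by gcongr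
    _ = Real.exp b * n.factorial / b ^ n * ((1 + ‖x‖) ^ n)⁻¹ := by
        rw [mul_pow]
        field_simp

theorem mul_exp_neg_mul_le {a : ℝ} (ha : 0 < a) (x : ℝ) : x * Real.exp (-(a * x)) ≤ a⁻¹ := by
  have hexp : a * x ≤ Real.exp (a * x) := by linarith [Real.add_one_le_exp (a * x)]
  rw [Real.exp_neg, ← div_eq_mul_inv, div_le_iff₀ (Real.exp_pos _), ← div_eq_inv_mul,
    le_div_iff₀ ha]
  linarith

theorem differentiableOn_integral_cexp_neg_mul {X : Type*} [MeasurableSpace X] {μ : Measure X}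
    {φ : X → ℝ} {g : X → ℂ} (hφ : AEStronglyMeasurable φ μ) (hφ_nonneg : ∀ᵐ x ∂μ, 0 ≤ φ x)
    (hint : ∀ z : ℂ, 0 < z.re → Integrable (fun x => Complex.exp (-z * φ x) * g x) μ) :
    DifferentiableOn ℂ (fun z : ℂ => ∫ x, Complex.exp (-z * φ x) * g x ∂μ) {z | 0 < z.re} := by
  intro z hz
  set a : ℝ := z.re / 4
  have ha : 0 < a := div_pos hz four_pos
  have hnhds : {w : ℂ | 2 * a < w.re} ∈ 𝓝 z :=
    (isOpen_lt continuous_const Complex.continuous_re).mem_nhds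
      (show 2 * (z.re / 4) < z.re by linarith [show 0 < z.re from hz])
  refine (hasDerivAt_integral_of_dominated_loc_of_deriv_le
    (F' := fun w x => (-φ x : ℂ) * (Complex.exp (-w * φ x) * g x))
    (bound := fun x => a⁻¹ * ‖Complex.exp (-(a : ℂ) * φ x) * g x‖)
    hnhds ?_ (hint z hz) ?_ ?_ ((hint a (by simpa using ha)).norm.const_mul _)
    ?_).2.differentiableAt.differentiableWithinAt
  · filter_upwards [hnhds] with w hw using (hint w (by linarith [show 2 * a < w.re from hw])).1
  · exact (Complex.continuous_ofReal.comp_aestronglyMeasurable hφ).neg.mul (hint z hz).1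
  · filter_upwards [hφ_nonneg] with x hx w hw
    have hexp : Real.exp (-w.re * φ x) ≤ Real.exp (-(a * φ x)) * Real.exp (-a * φ x) := by
      rw [← Real.exp_add, Real.exp_le_exp]
      nlinarith [show 2 * a < w.re from hw]
    simp only [norm_mul, norm_neg, Complex.norm_real, Real.norm_of_nonneg hx, Complex.norm_exp,
      Complex.re_mul_ofReal, Complex.neg_re, Complex.ofReal_re]
    calc φ x * (Real.exp (-w.re * φ x) * ‖g x‖)
        ≤ φ x * (Real.exp (-(a * φ x)) * Real.exp (-a * φ x) * ‖g x‖) := by gcongr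
      _ = φ x * Real.exp (-(a * φ x)) * (Real.exp (-a * φ x) * ‖g x‖) := by ring
      _ ≤ a⁻¹ * (Real.exp (-a * φ x) * ‖g x‖) := by gcongr; exact mul_exp_neg_mul_le ha _
  · refine Eventually.of_forall fun x w _ => ?_
    exact ((hasDerivAt_id w).neg.mul_const (φ x : ℂ)).cexp.mul_const (g x) |>.congr_deriv
      (by simp only [Pi.neg_apply, id]; ring)

theorem integral_Ioi_eq_integral_Ioi_add_mul_I {E : Type*} [NormedAddCommGroup E]
    [NormedSpace ℂ E] {f : ℂ → E} {c : ℝ} (hf : Differentiable ℂ f)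
    (hint : IntegrableOn (fun x : ℝ => f x) (Set.Ioi 0))
    (hint_shift : IntegrableOn (fun x : ℝ => f (x + c * Complex.I)) (Set.Ioi 0))
    (hside : Tendsto (fun T : ℝ => ∫ y in (0 : ℝ)..c, f (T + y * Complex.I)) atTop (𝓝 0)) :
    ∫ x in Set.Ioi (0 : ℝ), f x =
      (∫ x in Set.Ioi (0 : ℝ), f (x + c * Complex.I)) +
        Complex.I • ∫ y in (0 : ℝ)..c, f (y * Complex.I) := by
  have hrect (T : ℝ) :
      ((∫ x in (0 : ℝ)..T, f x) - ∫ x in (0 : ℝ)..T, f (x + c * Complex.I)) +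
        Complex.I • (∫ y in (0 : ℝ)..c, f (T + y * Complex.I)) -
        Complex.I • ∫ y in (0 : ℝ)..c, f (y * Complex.I) = 0 := by
    simpa using Complex.integral_boundary_rect_eq_zero_of_differentiableOn f 0
      (T + c * Complex.I) hf.differentiableOn
  have hlim := (((intervalIntegral_tendsto_integral_Ioi 0 hint tendsto_id).sub
    (intervalIntegral_tendsto_integral_Ioi 0 hint_shift tendsto_id)).add
    (hside.const_smul Complex.I)).sub_const
    (Complex.I • ∫ y in (0 : ℝ)..c, f (y * Complex.I))
  have hzero := tendsto_nhds_unique (hlim.congr hrect) tendsto_const_nhds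
  rwa [smul_zero, add_zero, sub_sub, sub_eq_zero] at hzero

end Integrals

section BesselK

theorem sq_div_two_le_sinh {u : ℝ} (hu : 0 ≤ u) : u ^ 2 / 2 ≤ Real.sinh u := by
  have hsinh : u / 2 ≤ Real.sinh (u / 2) := Real.self_le_sinh_iff.2 (by positivity)
  have hcosh : u / 2 ≤ Real.cosh (u / 2) := hsinh.trans (Real.sinh_lt_cosh _).le
  calc u ^ 2 / 2 = 2 * (u / 2) * (u / 2) := by ring
    _ ≤ 2 * Real.sinh (u / 2) * Real.cosh (u / 2) := by gcongr
    _ = Real.sinh u := by rw [← Real.sinh_two_mul, mul_div_cancel₀ u two_ne_zero]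

theorem cosh_le_exp_abs (x : ℝ) : Real.cosh x ≤ Real.exp |x| := by
  rw [← Real.cosh_abs, Real.cosh_eq]
  linarith [Real.exp_le_exp.2 (neg_le_self (abs_nonneg x))]

theorem norm_cosh_le (w : ℂ) : ‖Complex.cosh w‖ ≤ Real.cosh w.re := by
  rw [Complex.cosh, Real.cosh_eq, norm_div, Complex.norm_two, ← Complex.neg_re,
    ← Complex.norm_exp, ← Complex.norm_exp]
  gcongr
  exact norm_add_le _ _

theorem exp_neg_mul_sinh_mul_cosh_le {a : ℝ} (ha : 0 < a) (ν : ℝ) {u : ℝ} (hu : 0 ≤ u) :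
    Real.exp (-(a * Real.sinh u)) * Real.cosh (ν * u) ≤
      Real.exp ((1 + |ν|) ^ 2 / (2 * a)) * Real.exp (-u) := by
  have hsinh : a * (u ^ 2 / 2) ≤ a * Real.sinh u :=
    mul_le_mul_of_nonneg_left (sq_div_two_le_sinh hu) ha.le
  have hsq : (1 + |ν|) * u ≤ a * (u ^ 2 / 2) + (1 + |ν|) ^ 2 / (2 * a) := by
    have hcomplete : a * (u ^ 2 / 2) + (1 + |ν|) ^ 2 / (2 * a) - (1 + |ν|) * u =
        (a * u - (1 + |ν|)) ^ 2 / (2 * a) := by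
      field_simp
      ring
    linarith [show 0 ≤ (a * u - (1 + |ν|)) ^ 2 / (2 * a) by positivity]
  refine (mul_le_mul_of_nonneg_left (cosh_le_exp_abs _) (Real.exp_pos _).le).trans ?_
  rw [← Real.exp_add, ← Real.exp_add, Real.exp_le_exp, abs_mul, abs_of_nonneg hu]
  linarith

theorem integrableOn_exp_neg_mul_sinh_mul_cosh {a : ℝ} (ha : 0 < a) (ν : ℝ) :
    IntegrableOn (fun u : ℝ => Real.exp (-(a * Real.sinh u)) * Real.cosh (ν * u))
      (Set.Ioi 0) := by
  have hexp : IntegrableOn (fun u : ℝ => Real.exp (-u)) (Set.Ioi 0) := by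
    simpa using exp_neg_integrableOn_Ioi 0 one_pos
  refine (hexp.const_mul (Real.exp ((1 + |ν|) ^ 2 / (2 * a)))).mono'
    (Continuous.aestronglyMeasurable ?_) ?_
  · fun_prop
  · refine ae_restrict_of_forall_mem measurableSet_Ioi fun u hu => ?_
    rw [Real.norm_of_nonneg (mul_pos (Real.exp_pos _) (Real.cosh_pos _)).le]
    exact exp_neg_mul_sinh_mul_cosh_le ha ν (le_of_lt hu)

theorem norm_besselKIntegrand (ν : ℝ) (z : ℂ) (u : ℝ) :
    ‖Complex.exp (-z * Real.cosh u) * Real.cosh (ν * u)‖ =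
      Real.exp (-(z.re * Real.cosh u)) * Real.cosh (ν * u) := by
  rw [norm_mul, Complex.norm_exp, Complex.norm_real, Real.norm_of_nonneg (Real.cosh_pos _).le,
    Complex.re_mul_ofReal, Complex.neg_re, neg_mul]

theorem integrableOn_besselKIntegrand (ν : ℝ) {z : ℂ} (hz : 0 < z.re) :
    IntegrableOn (fun u : ℝ => Complex.exp (-z * Real.cosh u) * Real.cosh (ν * u))
      (Set.Ioi 0) := by
  refine (integrableOn_exp_neg_mul_sinh_mul_cosh hz ν).mono'
    (Continuous.aestronglyMeasurable ?_) (Eventually.of_forall fun u => ?_)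
  · fun_prop
  · rw [norm_besselKIntegrand]
    gcongr
    exact (Real.sinh_lt_cosh u).le

theorem norm_besselKIntegral_le (ν : ℝ) {a : ℝ} (ha : 0 < a) {z : ℂ} (hz : a ≤ z.re) :
    ‖besselKIntegral ν z‖ ≤ Real.exp (a - z.re) *
      ∫ u in Set.Ioi (0 : ℝ), ‖Complex.exp (-(a : ℂ) * Real.cosh u) * Real.cosh (ν * u)‖ := by
  rw [← integral_const_mul]
  refine norm_integral_le_of_norm_le
    ((integrableOn_besselKIntegrand ν (z := a) (by simpa using ha)).norm.const_mul _)
    (Eventually.of_forall fun u => ?_)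
  rw [norm_besselKIntegrand, norm_besselKIntegrand, Complex.ofReal_re, ← mul_assoc,
    ← Real.exp_add]
  gcongr
  nlinarith [Real.one_le_cosh u]

theorem differentiableOn_besselKIntegral (ν : ℝ) :
    DifferentiableOn ℂ (besselKIntegral ν) {z | 0 < z.re} :=
  differentiableOn_integral_cexp_neg_mul Real.continuous_cosh.aestronglyMeasurable
    (Eventually.of_forall fun u => (Real.cosh_pos u).le)
    fun _ hz => integrableOn_besselKIntegrand ν hz

theorem besselKIntegral_conj (ν : ℝ) (z : ℂ) :
    besselKIntegral ν (conj z) = conj (besselKIntegral ν z) := by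
  rw [besselKIntegral, besselKIntegral, ← integral_conj]
  simp only [map_mul, ← Complex.exp_conj, map_neg, Complex.conj_ofReal]

/-- The continuation of `K_ν` from the first quadrant to the upper half plane: the contour of
integration in `∫ e^{-z cosh w} cosh (ν w) dw` is moved from `[0, ∞)` to the broken line through
`0`, `-iπ/2` and `∞ - iπ/2`, on the unbounded part of which `cosh` becomes `-i sinh`. -/
noncomputable def besselKUpper (ν : ℝ) (z : ℂ) : ℂ :=
  (∫ u in Set.Ioi (0 : ℝ), Complex.exp (-(-Complex.I * z) * Real.sinh u) *
      Complex.cosh (ν * (u + (-(Real.pi / 2) : ℝ) * Complex.I))) +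
    Complex.I * ∫ y in (0 : ℝ)..(-(Real.pi / 2)),
      Complex.exp (-z * Real.cos y) * Complex.cosh (ν * (y * Complex.I))

theorem integrableOn_besselKUpperIntegrand (ν : ℝ) {z : ℂ} (hz : 0 < z.re) :
    IntegrableOn (fun u : ℝ => Complex.exp (-z * Real.sinh u) *
      Complex.cosh (ν * (u + (-(Real.pi / 2) : ℝ) * Complex.I))) (Set.Ioi 0) := by
  refine (integrableOn_exp_neg_mul_sinh_mul_cosh hz ν).mono'
    (Continuous.aestronglyMeasurable ?_) (Eventually.of_forall fun u => ?_)
  · fun_prop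
  · rw [norm_mul, Complex.norm_exp, Complex.re_mul_ofReal, Complex.neg_re, neg_mul]
    gcongr
    exact (norm_cosh_le _).trans_eq (by simp)

theorem continuousOn_besselKUpper (ν : ℝ) : ContinuousOn (besselKUpper ν) {z | 0 < z.im} := by
  have hray := (differentiableOn_integral_cexp_neg_mul (μ := volume.restrict (Set.Ioi (0 : ℝ)))
    Real.continuous_sinh.aestronglyMeasurable
    (ae_restrict_of_forall_mem measurableSet_Ioi fun u hu => (Real.sinh_pos_iff.2 hu).le)
    fun _ hz => integrableOn_besselKUpperIntegrand ν hz).continuousOn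
  refine (hray.comp (f := fun z : ℂ => -Complex.I * z) (by fun_prop)
    fun z hz => by simpa using hz).add (continuousOn_const.mul (Continuous.continuousOn ?_))
  refine intervalIntegral.continuous_parametric_intervalIntegral_of_continuous' ?_ _ _
  fun_prop

theorem mul_sinh_le_re_mul_cosh {z : ℂ} {a : ℝ} (ha : 0 ≤ a) (hr : a ≤ z.re) (hi : a ≤ z.im)
    {T : ℝ} (hT : 0 ≤ T) {y : ℝ} (hy : y ∈ Set.Icc (-(Real.pi / 2)) 0) :
    a * Real.sinh T ≤ (z * Complex.cosh (T + y * Complex.I)).re := by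
  have hcos : 0 ≤ Real.cos y :=
    Real.cos_nonneg_of_mem_Icc ⟨hy.1, hy.2.trans (by positivity)⟩
  have hsin : 0 ≤ -Real.sin y := neg_nonneg.2
    (Real.sin_nonpos_of_nonpos_of_neg_pi_le hy.2 (by linarith [hy.1, Real.pi_pos]))
  have hcos_sin : 1 ≤ Real.cos y + -Real.sin y := by
    nlinarith [Real.sin_sq_add_cos_sq y, mul_nonneg hcos hsin]
  have hre : (z * Complex.cosh (T + y * Complex.I)).re =
      z.re * (Real.cosh T * Real.cos y) + z.im * (Real.sinh T * -Real.sin y) := by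
    have hcosh : Complex.cosh (T + y * Complex.I) = ((Real.cosh T * Real.cos y : ℝ) : ℂ) +
        ((Real.sinh T * Real.sin y : ℝ) : ℂ) * Complex.I := by
      rw [Complex.cosh_add, Complex.cosh_mul_I, Complex.sinh_mul_I]
      push_cast
      ring
    rw [hcosh, Complex.mul_re, Complex.add_re, Complex.add_im, Complex.ofReal_re,
      Complex.ofReal_im, Complex.re_ofReal_mul, Complex.im_ofReal_mul, Complex.I_re, Complex.I_im]
    ring
  calc a * Real.sinh T ≤ a * Real.sinh T * (Real.cos y + -Real.sin y) :=
        le_mul_of_one_le_right (by positivity) hcos_sin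
    _ = a * (Real.sinh T * Real.cos y) + a * (Real.sinh T * -Real.sin y) := by ring
    _ ≤ z.re * (Real.cosh T * Real.cos y) + z.im * (Real.sinh T * -Real.sin y) := by
        gcongr
        · exact ha.trans hr
        · exact (Real.sinh_lt_cosh T).le
    _ = _ := hre.symm

theorem tendsto_integral_besselK_side (ν : ℝ) {z : ℂ} (hr : 0 < z.re) (hi : 0 < z.im) :
    Tendsto (fun T : ℝ => ∫ y in (0 : ℝ)..(-(Real.pi / 2)),
      Complex.exp (-z * Complex.cosh (T + y * Complex.I)) *
        Complex.cosh (ν * (T + y * Complex.I))) atTop (𝓝 0) := by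
  set a := min z.re z.im
  have ha : 0 < a := lt_min hr hi
  have hdecay : Tendsto (fun T : ℝ => Real.exp ((1 + |ν|) ^ 2 / (2 * a)) * Real.exp (-T) *
      |(-(Real.pi / 2)) - 0|) atTop (𝓝 0) := by
    simpa using (Real.tendsto_exp_neg_atTop_nhds_zero.const_mul _).mul_const _
  refine squeeze_zero_norm' ?_ hdecay
  filter_upwards [eventually_ge_atTop 0] with T hT
  refine intervalIntegral.norm_integral_le_of_norm_le_const fun y hy => ?_
  rw [Set.uIoc_of_ge (by linarith [Real.pi_pos])] at hy
  refine le_trans ?_ (exp_neg_mul_sinh_mul_cosh_le ha ν hT)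
  rw [norm_mul, Complex.norm_exp, neg_mul, Complex.neg_re]
  gcongr
  · exact mul_sinh_le_re_mul_cosh ha.le (min_le_left _ _) (min_le_right _ _) hT ⟨hy.1.le, hy.2⟩
  · exact (norm_cosh_le _).trans_eq (by simp)

theorem besselKIntegral_eq_besselKUpper (ν : ℝ) {z : ℂ} (hr : 0 < z.re) (hi : 0 < z.im) :
    besselKIntegral ν z = besselKUpper ν z := by
  let f : ℂ → ℂ := fun w => Complex.exp (-z * Complex.cosh w) * Complex.cosh (ν * w)
  have hf : Differentiable ℂ f := by
    have := Complex.differentiable_cosh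
    fun_prop
  have hreal (x : ℝ) : f x = Complex.exp (-z * Real.cosh x) * Real.cosh (ν * x) := by
    simp [f]
  have hshift (x : ℝ) : f (x + (-(Real.pi / 2) : ℝ) * Complex.I) =
      Complex.exp (-(-Complex.I * z) * Real.sinh x) *
        Complex.cosh (ν * (x + (-(Real.pi / 2) : ℝ) * Complex.I)) := by
    simp only [f]
    rw [Complex.cosh_add, Complex.cosh_mul_I, Complex.sinh_mul_I, ← Complex.ofReal_cos,
      ← Complex.ofReal_sin, Real.cos_neg, Real.cos_pi_div_two, Real.sin_neg, Real.sin_pi_div_two]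
    push_cast
    ring_nf
  have himag (y : ℝ) : f (y * Complex.I) =
      Complex.exp (-z * Real.cos y) * Complex.cosh (ν * (y * Complex.I)) := by
    simp only [f]
    rw [Complex.cosh_mul_I, Complex.ofReal_cos]
  have hcontour := integral_Ioi_eq_integral_Ioi_add_mul_I (c := -(Real.pi / 2)) hf
    (by simpa only [hreal] using integrableOn_besselKIntegrand ν hr)
    (by simpa only [hshift] using integrableOn_besselKUpperIntegrand ν (by simpa using hi))
    (tendsto_integral_besselK_side ν hr hi)
  rw [besselKIntegral, besselKUpper]
  simpa only [hreal, hshift, himag, smul_eq_mul] using hcontour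

theorem besselK_eq_of_eventuallyEq (ν : ℝ) {z : ℂ} (hz : 0 ≤ z.re) {H : ℂ → ℂ}
    (hH : ContinuousAt H z) (h : ∀ᶠ w in 𝓝 z, 0 < w.re → besselKIntegral ν w = H w) :
    besselK ν z = H z := by
  by_cases hpos : 0 < z.re
  · rw [besselK, if_pos hpos]
    exact h.self_of_nhds hpos
  · have : (𝓝[{w : ℂ | 0 < w.re}] z).NeBot := by
      rw [← mem_closure_iff_nhdsWithin_neBot, Complex.closure_setOfPred_lt_re]
      exact hz
    rw [besselK, if_neg hpos]
    refine Tendsto.limUnder_eq ((hH.mono_left nhdsWithin_le_nhds).congr' ?_)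
    filter_upwards [nhdsWithin_le_nhds h, self_mem_nhdsWithin] with w hw hwre using (hw hwre).symm

theorem continuousWithinAt_besselK (ν : ℝ) {U : Set ℂ} (hU : IsOpen U) {H : ℂ → ℂ}
    (hH : ContinuousOn H U) (hK : ∀ z ∈ U, 0 < z.re → besselKIntegral ν z = H z) {z : ℂ}
    (hz : z ∈ U) (hre : 0 ≤ z.re) : ContinuousWithinAt (besselK ν) {z : ℂ | 0 ≤ z.re} z := by
  have heq : ∀ w ∈ U, 0 ≤ w.re → besselK ν w = H w := fun w hw hw_re =>
    besselK_eq_of_eventuallyEq ν hw_re (hH.continuousAt (hU.mem_nhds hw))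
      (mem_of_superset (hU.mem_nhds hw) hK)
  refine (hH.continuousAt (hU.mem_nhds hz)).continuousWithinAt.congr_of_eventuallyEq ?_
    (heq z hz hre)
  filter_upwards [nhdsWithin_le_nhds (hU.mem_nhds hz), self_mem_nhdsWithin] using heq

theorem continuousOn_besselK (ν : ℝ) :
    ContinuousOn (besselK ν) {z : ℂ | 0 ≤ z.re ∧ z ≠ 0} := by
  rintro z ⟨hre, hz⟩
  refine ContinuousWithinAt.mono ?_ fun w hw => hw.1
  rcases lt_trichotomy z.im 0 with him | him | him
  · refine continuousWithinAt_besselK ν (isOpen_lt Complex.continuous_im continuous_const)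
      (H := fun z => conj (besselKUpper ν (conj z))) ?_ (fun w him hre => ?_) him hre
    · exact Complex.continuous_conj.comp_continuousOn ((continuousOn_besselKUpper ν).comp
        Complex.continuous_conj.continuousOn fun w hw => by simpa using hw)
    · rw [← besselKIntegral_eq_besselKUpper ν (by simpa using hre) (by simpa using him),
        besselKIntegral_conj, Complex.conj_conj]
  · exact continuousWithinAt_besselK ν (isOpen_lt continuous_const Complex.continuous_re)
      (differentiableOn_besselKIntegral ν).continuousOn (fun _ _ _ => rfl)
      (lt_of_le_of_ne hre fun h => hz (Complex.ext h.symm him)) hre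
  · exact continuousWithinAt_besselK ν (isOpen_lt continuous_const Complex.continuous_im)
      (continuousOn_besselKUpper ν)
      (fun w him hre => besselKIntegral_eq_besselKUpper ν hre him) him hre

end BesselK

section BesselIntegrals

theorem integrable_of_integrableOn_Ioi {E : Type*} [NormedAddCommGroup E] {f : ℝ → E}
    (hpos : IntegrableOn f (Set.Ioi 0)) (hneg : IntegrableOn (fun x => f (-x)) (Set.Ioi 0)) :
    Integrable f := by
  rw [← integrableOn_univ, ← Set.Iic_union_Ioi (a := (0 : ℝ)), integrableOn_union]
  refine ⟨Iff.mpr integrableOn_Iic_iff_integrableOn_Iio ?_, hpos⟩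
  have hneg' : IntegrableOn (fun x => f (-x)) (Set.Ioi (-0)) := by simpa using hneg
  simpa using hneg'.comp_neg_Iio

theorem integral_eq_integral_Ioi_add_comp_neg {E : Type*} [NormedAddCommGroup E]
    [NormedSpace ℝ E] {f : ℝ → E} (hf : Integrable f) :
    ∫ x, f x = ∫ x in Set.Ioi (0 : ℝ), (f x + f (-x)) := by
  rw [integral_add hf.integrableOn hf.comp_neg.integrableOn, integral_comp_neg_Ioi, neg_zero,
    add_comm, intervalIntegral.integral_Iic_add_Ioi hf.integrableOn hf.integrableOn]

theorem integrableOn_exp_neg_mul_cosh_mul_cosh (ν : ℝ) {x : ℝ} (hx : 0 < x) :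
    IntegrableOn (fun u : ℝ => Real.exp (-(x * Real.cosh u)) * Real.cosh (ν * u))
      (Set.Ioi 0) := by
  simpa only [IntegrableOn, norm_besselKIntegrand, Complex.ofReal_re] using
    (integrableOn_besselKIntegrand ν (z := x) (by simpa using hx)).norm

theorem besselKIntegral_ofReal (ν x : ℝ) :
    besselKIntegral ν x = ((∫ u in Set.Ioi (0 : ℝ),
      Real.exp (-(x * Real.cosh u)) * Real.cosh (ν * u) : ℝ) : ℂ) := by
  rw [besselKIntegral, ← integral_complex_ofReal]
  push_cast
  simp only [neg_mul]

theorem besselKIntegral_neg (ν : ℝ) (z : ℂ) : besselKIntegral (-ν) z = besselKIntegral ν z := by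
  simp only [besselKIntegral, neg_mul, Real.cosh_neg]

theorem besselKIntegral_one_half {x : ℝ} (hx : 0 < x) :
    besselKIntegral (1 / 2) x = ((Real.sqrt (Real.pi / (2 * x)) * Real.exp (-x) : ℝ) : ℂ) := by
  let g : ℝ → ℝ := fun v => 2 * Real.exp (-x) * Real.exp (-(2 * x) * v ^ 2)
  have hg : Continuous g := by fun_prop
  have hsubst (u : ℝ) : Real.exp (-(x * Real.cosh u)) * Real.cosh (1 / 2 * u) =
      (g ∘ fun u => Real.sinh (1 / 2 * u)) u * (Real.cosh (1 / 2 * u) * (1 / 2)) := by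
    have hdouble : Real.cosh u = 1 + 2 * Real.sinh (1 / 2 * u) ^ 2 := by
      conv_lhs => rw [show u = 2 * (1 / 2 * u) by ring, Real.cosh_two_mul, Real.cosh_sq]
      ring
    simp only [g, Function.comp_apply]
    rw [hdouble, mul_assoc 2, ← Real.exp_add]
    ring_nf
  have hint := integrableOn_exp_neg_mul_cosh_mul_cosh (1 / 2) hx
  rw [besselKIntegral_ofReal]
  simp only [hsubst] at hint ⊢
  rw [integral_comp_mul_deriv_Ioi (f := fun u => Real.sinh (1 / 2 * u)) (by fun_prop)
    (Real.sinhOrderIso.tendsto_atTop.comp (tendsto_id.const_mul_atTop (by norm_num)))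
    (fun u _ => (((hasDerivAt_id u).const_mul (1 / 2 : ℝ)).sinh.congr_deriv
      (by simp)).hasDerivWithinAt) hg.continuousOn
    (((integrable_exp_neg_mul_sq (by positivity)).const_mul _).integrableOn)
    (Iff.mpr integrableOn_Ici_iff_integrableOn_Ioi hint), mul_zero, Real.sinh_zero,
    integral_const_mul, integral_gaussian_Ioi]
  congr 1
  ring

theorem integrable_exp_mul_sub_mul_cosh (ν : ℝ) {x : ℝ} (hx : 0 < x) :
    Integrable fun u : ℝ => Real.exp (ν * u - x * Real.cosh u) := by
  have hpos (μ : ℝ) : IntegrableOn (fun u : ℝ => Real.exp (μ * u - x * Real.cosh u))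
      (Set.Ioi 0) := by
    refine ((integrableOn_exp_neg_mul_cosh_mul_cosh μ hx).const_mul 2).mono'
      (Continuous.aestronglyMeasurable (by fun_prop)) (Eventually.of_forall fun u => ?_)
    rw [Real.norm_of_nonneg (Real.exp_pos _).le, sub_eq_neg_add, Real.exp_add, mul_left_comm]
    gcongr
    rw [Real.cosh_eq]
    linarith [Real.exp_pos (-(μ * u))]
  refine integrable_of_integrableOn_Ioi (hpos ν) ?_
  simpa only [mul_neg, neg_mul, Real.cosh_neg] using hpos (-ν)

theorem integral_exp_mul_sub_mul_cosh (ν : ℝ) {x : ℝ} (hx : 0 < x) :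
    ((∫ u : ℝ, Real.exp (ν * u - x * Real.cosh u) : ℝ) : ℂ) = 2 * besselKIntegral ν x := by
  rw [integral_eq_integral_Ioi_add_comp_neg (integrable_exp_mul_sub_mul_cosh ν hx),
    besselKIntegral_ofReal, ← Complex.ofReal_ofNat, ← Complex.ofReal_mul, ← integral_const_mul]
  congr 2 with u
  rw [Real.cosh_neg, mul_neg, sub_eq_neg_add, sub_eq_neg_add, Real.exp_add, Real.exp_add,
    Real.cosh_eq (ν * u)]
  ring

theorem exp_shift_log_div {a b : ℝ} (ha : 0 < a) (hb : 0 < b) (ν u : ℝ) :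
    Real.exp (ν * (u + Real.log (a / b)) - a ^ 2 * Real.exp (-(u + Real.log (a / b))) -
      b ^ 2 * Real.exp (u + Real.log (a / b))) =
    (a / b) ^ ν * Real.exp (ν * u - 2 * a * b * Real.cosh u) := by
  have hab : 0 < a / b := by positivity
  rw [neg_add, Real.exp_add u, Real.exp_add (-u), Real.exp_neg (Real.log _), Real.exp_log hab,
    Real.rpow_def_of_pos hab, ← Real.exp_add, Real.cosh_eq]
  congr 1
  field_simp
  ring

theorem integrable_exp_mul_sub_exp_neg_sub_exp {a b : ℝ} (ha : 0 < a) (hb : 0 < b) (ν : ℝ) :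
    Integrable fun u : ℝ => Real.exp (ν * u - a ^ 2 * Real.exp (-u) - b ^ 2 * Real.exp u) := by
  have hint := (integrable_exp_mul_sub_mul_cosh ν (x := 2 * a * b) (by positivity)).const_mul
    ((a / b) ^ ν)
  simp only [← exp_shift_log_div ha hb] at hint
  simpa using hint.comp_add_right (-Real.log (a / b))

theorem integral_exp_mul_sub_exp_neg_sub_exp {a b : ℝ} (ha : 0 < a) (hb : 0 < b) (ν : ℝ) :
    ((∫ u : ℝ, Real.exp (ν * u - a ^ 2 * Real.exp (-u) - b ^ 2 * Real.exp u) : ℝ) : ℂ) =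
      2 * ((a / b) ^ ν : ℝ) * besselKIntegral ν (2 * a * b : ℝ) := by
  rw [← integral_add_right_eq_self _ (Real.log (a / b))]
  simp only [exp_shift_log_div ha hb]
  rw [integral_const_mul, Complex.ofReal_mul, integral_exp_mul_sub_mul_cosh ν (by positivity)]
  ring

theorem integral_exp_neg_half_subordination {a b : ℝ} (ha : 0 < a) (hb : 0 < b) :
    ∫ u : ℝ, Real.exp (-(1 / 2) * u - a ^ 2 * Real.exp (-u) - b ^ 2 * Real.exp u) =
      Real.sqrt Real.pi / a * Real.exp (-(2 * a * b)) := by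
  apply Complex.ofReal_injective
  rw [integral_exp_mul_sub_exp_neg_sub_exp ha hb, besselKIntegral_neg,
    besselKIntegral_one_half (by positivity), ← Complex.ofReal_ofNat, ← Complex.ofReal_mul,
    ← Complex.ofReal_mul, Complex.ofReal_inj, Real.rpow_neg (by positivity), ← Real.sqrt_eq_rpow,
    show Real.pi / (2 * (2 * a * b)) = Real.pi / (2 * a) ^ 2 * (a / b) by field_simp,
    Real.sqrt_mul (by positivity), Real.sqrt_div Real.pi_pos.le, Real.sqrt_sq (by positivity)]
  have : Real.sqrt (a / b) ≠ 0 := (Real.sqrt_pos.2 (by positivity)).ne'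
  field_simp

end BesselIntegrals

section SpacetimeRoot

/-- The principal square root `√(r² - ζ²)` of the interval between the spatial distance `r` and the
complex time `ζ`, the argument of the Bessel function in `timeKernel`. -/
noncomputable def spacetimeRoot (ζ : ℂ) (r : ℝ) : ℂ := ((r : ℂ) ^ 2 - ζ ^ 2) ^ (1 / 2 : ℂ)

theorem re_cpow_half_pos {v : ℂ} (hv : v ∈ Complex.slitPlane) : 0 < (v ^ (1 / 2 : ℂ)).re := by
  have harg := Complex.mem_slitPlane_iff_arg.1 hv
  have him : (Complex.log v * (1 / 2)).im = v.arg / 2 := by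
    simp [Complex.mul_im, Complex.log_im, div_eq_mul_inv]
  rw [Complex.cpow_def_of_ne_zero harg.2, Complex.exp_re, him]
  refine mul_pos (Real.exp_pos _) (Real.cos_pos_of_mem_Ioo ⟨?_, ?_⟩)
  · linarith [Complex.neg_pi_lt_arg v]
  · linarith [lt_of_le_of_ne (Complex.arg_le_pi v) harg.1]

theorem ofReal_sqrt_eq_cpow_half {x : ℝ} (hx : 0 ≤ x) :
    ((Real.sqrt x : ℝ) : ℂ) = (x : ℂ) ^ (1 / 2 : ℂ) := by
  rw [Real.sqrt_eq_rpow, Complex.ofReal_cpow hx]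
  push_cast
  rfl

theorem cpow_half_eq_I_mul_neg_cpow_half {v : ℂ} {σ : ℝ} (hσ : σ ^ 2 = 1) (hv : 0 < σ * v.im) :
    v ^ (1 / 2 : ℂ) = Complex.I * σ * (-v) ^ (1 / 2 : ℂ) := by
  have hv_im : v.im ≠ 0 := right_ne_zero_of_mul hv.ne'
  have hroot := re_cpow_half_pos (Complex.mem_slitPlane_iff.2 (Or.inr hv_im))
  have hroot_neg := re_cpow_half_pos (v := -v)
    (Complex.mem_slitPlane_iff.2 (Or.inr (by simpa using hv_im)))
  have hsq : (v ^ (1 / 2 : ℂ)) ^ 2 = v := by simp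
  have hsq_neg : ((-v) ^ (1 / 2 : ℂ)) ^ 2 = -v := by simp
  set q := v ^ (1 / 2 : ℂ)
  set q' := (-v) ^ (1 / 2 : ℂ)
  have hσ' : (σ : ℂ) ^ 2 = 1 := by exact_mod_cast hσ
  have hsq_eq : q ^ 2 = (Complex.I * σ * q') ^ 2 := by
    rw [mul_pow, mul_pow, Complex.I_sq, hσ', hsq, hsq_neg]
    ring
  refine (sq_eq_sq_iff_eq_or_eq_neg.1 hsq_eq).resolve_right fun hneg => ?_
  have him : q.im = -(σ * q'.re) := by
    rw [hneg]
    simp [mul_assoc]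
  have hv_eq : v.im = 2 * q.re * q.im := by
    rw [← hsq, sq, Complex.mul_im]
    ring
  rw [hv_eq, him] at hv
  nlinarith [mul_pos hroot hroot_neg]

theorem spacetimeRoot_sq (ζ : ℂ) (r : ℝ) : spacetimeRoot ζ r ^ 2 = (r : ℂ) ^ 2 - ζ ^ 2 := by
  simp [spacetimeRoot]

theorem re_ofReal_sq_sub_sq (r : ℝ) (ζ : ℂ) :
    ((r : ℂ) ^ 2 - ζ ^ 2).re = r ^ 2 - ζ.re ^ 2 + ζ.im ^ 2 := by
  simp [sq]
  ring

theorem im_ofReal_sq_sub_sq (r : ℝ) (ζ : ℂ) :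
    ((r : ℂ) ^ 2 - ζ ^ 2).im = -2 * ζ.re * ζ.im := by
  simp [sq]
  ring

theorem ofReal_sq_sub_sq_ne_zero {r : ℝ} {ζ : ℂ} (h : |r| ≠ |ζ.re|) : (r : ℂ) ^ 2 - ζ ^ 2 ≠ 0 := by
  intro hzero
  rcases sq_eq_sq_iff_eq_or_eq_neg.1 (sub_eq_zero.1 hzero) with hr | hr <;>
  exact h (by simpa using congrArg (fun z : ℂ => |z.re|) hr)

theorem ofReal_sq_sub_sq_mem_slitPlane (r : ℝ) {ζ : ℂ} (hζ : ζ.im ≠ 0) :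
    (r : ℂ) ^ 2 - ζ ^ 2 ∈ Complex.slitPlane := by
  rw [Complex.mem_slitPlane_iff, re_ofReal_sq_sub_sq, im_ofReal_sq_sub_sq]
  by_cases hre : ζ.re = 0
  · left
    rw [hre]
    nlinarith [sq_nonneg r, sq_pos_of_ne_zero hζ]
  · right
    simp [hre, hζ]

theorem re_spacetimeRoot_pos {ζ : ℂ} (hζ : ζ.im ≠ 0) (r : ℝ) : 0 < (spacetimeRoot ζ r).re :=
  re_cpow_half_pos (ofReal_sq_sub_sq_mem_slitPlane r hζ)

theorem sub_abs_re_le_re_spacetimeRoot {ζ : ℂ} (hζ : ζ.im ≠ 0) (r : ℝ) :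
    r - |ζ.re| ≤ (spacetimeRoot ζ r).re := by
  have hpos := re_spacetimeRoot_pos hζ r
  have hsq := congrArg Complex.re (spacetimeRoot_sq ζ r)
  rw [re_ofReal_sq_sub_sq, sq, Complex.mul_re] at hsq
  refine sub_le_iff_le_add.2 (abs_le_of_sq_le_sq' ?_ (by positivity)).2
  nlinarith [sq_abs ζ.re, abs_nonneg ζ.re, sq_nonneg ζ.im, sq_nonneg (spacetimeRoot ζ r).im]

theorem continuous_spacetimeRoot {ζ : ℂ} (hζ : ζ.im ≠ 0) : Continuous (spacetimeRoot ζ) :=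
  Continuous.cpow (by fun_prop) continuous_const fun r => ofReal_sq_sub_sq_mem_slitPlane r hζ

theorem differentiableAt_spacetimeRoot {ζ : ℂ} (hζ : ζ.im ≠ 0) (r : ℝ) :
    DifferentiableAt ℂ (fun ζ => spacetimeRoot ζ r) ζ :=
  DifferentiableAt.cpow_const (by fun_prop) (ofReal_sq_sub_sq_mem_slitPlane r hζ)

theorem spacetimeRoot_neg_I_mul (s r : ℝ) :
    spacetimeRoot (-(Complex.I * s)) r = (Real.sqrt (r ^ 2 + s ^ 2) : ℝ) := by
  rw [spacetimeRoot, ofReal_sqrt_eq_cpow_half (by positivity), neg_sq, mul_pow, Complex.I_sq]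
  push_cast
  ring_nf

theorem tendsto_ofReal_sub_mul_I (t : ℝ) :
    Tendsto (fun ε : ℝ => (t : ℂ) - ε * Complex.I) (𝓝[>] 0) (𝓝 t) := by
  have hcont : Continuous fun ε : ℝ => (t : ℂ) - ε * Complex.I := by fun_prop
  simpa using (hcont.tendsto 0).mono_left nhdsWithin_le_nhds

theorem tendsto_spacetimeRoot_lightConeRoot {t : ℝ} {w : Space3} (hw : ‖w‖ ≠ |t|) :
    Tendsto (fun ε : ℝ => spacetimeRoot (t - ε * Complex.I) ‖w‖) (𝓝[>] 0)
      (𝓝 (lightConeRoot t w)) := by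
  have hlim : Tendsto (fun ε : ℝ => (‖w‖ : ℂ) ^ 2 - (t - ε * Complex.I) ^ 2) (𝓝[>] 0)
      (𝓝 ((‖w‖ ^ 2 - t ^ 2 : ℝ) : ℂ)) := by
    simpa using tendsto_const_nhds.sub ((tendsto_ofReal_sub_mul_I t).pow 2)
  rcases lt_or_gt_of_ne hw with hlt | hgt
  · have ht : t ≠ 0 := abs_pos.1 ((norm_nonneg w).trans_lt hlt)
    have hpos : 0 < t ^ 2 - ‖w‖ ^ 2 := sub_pos.2 (sq_lt_sq.2 (by rwa [abs_norm]))
    have hsign : (SignType.sign t : ℝ) ^ 2 = 1 := by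
      rcases lt_or_gt_of_ne ht with h | h <;> simp [h]
    have hneg := hlim.neg.cpow (tendsto_const_nhds (x := (1 / 2 : ℂ))) (by
      rw [← Complex.ofReal_neg, neg_sub]
      exact Complex.ofReal_mem_slitPlane.2 hpos)
    rw [← Complex.ofReal_neg, neg_sub, ← ofReal_sqrt_eq_cpow_half hpos.le] at hneg
    rw [lightConeRoot, if_neg (not_le.2 hlt)]
    refine (hneg.const_mul _).congr' ?_
    filter_upwards [self_mem_nhdsWithin] with ε hε
    refine (cpow_half_eq_I_mul_neg_cpow_half hsign ?_).symm
    have hsign_mul : 0 < (SignType.sign t : ℝ) * t := by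
      rw [sign_mul_self]
      exact abs_pos.2 ht
    have him : ((‖w‖ : ℂ) ^ 2 - (t - ε * Complex.I) ^ 2).im = 2 * (t * ε) := by
      rw [im_ofReal_sq_sub_sq]
      simp [mul_assoc]
    rw [him]
    linarith [mul_pos hsign_mul (Set.mem_Ioi.1 hε)]
  · have hpos : 0 < ‖w‖ ^ 2 - t ^ 2 := sub_pos.2 (sq_lt_sq.2 (by rwa [abs_norm]))
    rw [lightConeRoot, if_pos hgt.le, ofReal_sqrt_eq_cpow_half hpos.le]
    exact hlim.cpow tendsto_const_nhds (Complex.ofReal_mem_slitPlane.2 hpos)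

theorem lightConeRoot_sq {t : ℝ} {w : Space3} (hw : ‖w‖ ≠ |t|) :
    lightConeRoot t w ^ 2 = (‖w‖ : ℂ) ^ 2 - (t : ℂ) ^ 2 := by
  refine tendsto_nhds_unique ((tendsto_spacetimeRoot_lightConeRoot hw).pow 2) ?_
  simp only [spacetimeRoot_sq]
  exact tendsto_const_nhds.sub ((tendsto_ofReal_sub_mul_I t).pow 2)

end SpacetimeRoot

section TimeKernel

variable {m : ℝ}

/-- The common expression `(i ζ / 2π²) · m² K₂(m q) / q²` of `timeKernel` and `realTimeKernel`, as a
function of the time `ζ` and of a value `q` of the root `√(|𝐰|² - ζ²)`. -/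
noncomputable def kernelOfRoot (m : ℝ) (ζ q : ℂ) : ℂ :=
  Complex.I * ζ / (2 * (Real.pi : ℂ) ^ 2) * ((m : ℂ) ^ 2 * besselK 2 (m * q) / q ^ 2)

theorem timeKernel_eq_kernelOfRoot (m : ℝ) (ζ : ℂ) (w : Space3) :
    timeKernel m ζ w = kernelOfRoot m ζ (spacetimeRoot ζ ‖w‖) := by
  rw [kernelOfRoot, spacetimeRoot_sq, timeKernel, spacetimeRoot]

theorem realTimeKernel_eq_kernelOfRoot (m : ℝ) {t : ℝ} {w : Space3} (hw : ‖w‖ ≠ |t|) :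
    realTimeKernel m t w = kernelOfRoot m t (lightConeRoot t w) := by
  rw [kernelOfRoot, lightConeRoot_sq hw, realTimeKernel]

theorem kernelOfRoot_of_re_pos (hm : 0 < m) (ζ : ℂ) {q : ℂ} (hq : 0 < q.re) :
    kernelOfRoot m ζ q = Complex.I * ζ / (2 * (Real.pi : ℂ) ^ 2) *
      ((m : ℂ) ^ 2 * besselKIntegral 2 (m * q) / q ^ 2) := by
  rw [kernelOfRoot, besselK, if_pos (by simpa using mul_pos hm hq)]

theorem continuousOn_kernelOfRoot (hm : 0 < m) :
    ContinuousOn (fun x : ℂ × ℂ => kernelOfRoot m x.1 x.2) {x | 0 ≤ x.2.re ∧ x.2 ≠ 0} := by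
  have hbessel : ContinuousOn (fun x : ℂ × ℂ => besselK 2 (m * x.2))
      {x | 0 ≤ x.2.re ∧ x.2 ≠ 0} :=
    (continuousOn_besselK 2).comp (by fun_prop) fun x hx =>
      ⟨by simpa using mul_nonneg hm.le hx.1, mul_ne_zero (by exact_mod_cast hm.ne') hx.2⟩
  unfold kernelOfRoot
  exact ContinuousOn.mul (by fun_prop) ((continuousOn_const.mul hbessel).div (by fun_prop)
    fun x hx => pow_ne_zero 2 hx.2)

theorem continuous_timeKernel (hm : 0 < m) {ζ : ℂ} (hζ : ζ.im ≠ 0) :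
    Continuous (timeKernel m ζ) := by
  rw [funext (timeKernel_eq_kernelOfRoot m ζ)]
  have hroot : Continuous fun w : Space3 => (ζ, spacetimeRoot ζ ‖w‖) :=
    continuous_const.prodMk ((continuous_spacetimeRoot hζ).comp continuous_norm)
  exact (continuousOn_kernelOfRoot hm).comp_continuous hroot fun w =>
    have hpos := re_spacetimeRoot_pos hζ ‖w‖
    ⟨hpos.le, Complex.ne_zero_of_re_pos hpos⟩

theorem differentiableOn_timeKernel (hm : 0 < m) (w : Space3) :
    DifferentiableOn ℂ (fun ζ => timeKernel m ζ w) {ζ | ζ.im ≠ 0} := by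
  intro ζ hζ
  have hpos := re_spacetimeRoot_pos hζ ‖w‖
  have hroot := differentiableAt_spacetimeRoot hζ ‖w‖
  have hbessel : DifferentiableAt ℂ (fun ζ => besselKIntegral 2 (m * spacetimeRoot ζ ‖w‖)) ζ :=
    ((differentiableOn_besselKIntegral 2).differentiableAt
      ((isOpen_lt continuous_const Complex.continuous_re).mem_nhds
        (by simpa using mul_pos hm hpos))).comp ζ (hroot.const_mul (m : ℂ))
  have hkernel := DifferentiableAt.mul
    (a := fun ζ : ℂ => Complex.I * ζ / (2 * (Real.pi : ℂ) ^ 2)) (by fun_prop)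
    ((hbessel.const_mul ((m : ℂ) ^ 2)).div (hroot.pow 2)
      (pow_ne_zero 2 (Complex.ne_zero_of_re_pos hpos)))
  refine hkernel.differentiableWithinAt.congr (fun ζ hζ => ?_) ?_ <;>
  · rw [timeKernel_eq_kernelOfRoot, kernelOfRoot_of_re_pos hm _ (re_spacetimeRoot_pos hζ ‖w‖)]
    rfl

theorem isBigO_timeKernel (hm : 0 < m) {ζ : ℂ} (hζ : ζ.im ≠ 0) :
    timeKernel m ζ =O[cocompact Space3] fun w => Real.exp (-m * ‖w‖) := by
  set C := ∫ u in Set.Ioi (0 : ℝ), ‖Complex.exp (-(m : ℂ) * Real.cosh u) * Real.cosh (2 * u)‖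
  refine Asymptotics.IsBigO.of_bound
    (‖Complex.I * ζ / (2 * (Real.pi : ℂ) ^ 2)‖ * (m ^ 2 * (Real.exp (m + m * |ζ.re|) * C))) ?_
  filter_upwards [tendsto_norm_cocompact_atTop.eventually_ge_atTop (1 + |ζ.re|)] with w hw
  have hroot := sub_abs_re_le_re_spacetimeRoot hζ ‖w‖
  have hroot_one : 1 ≤ (spacetimeRoot ζ ‖w‖).re := by linarith
  have hroot_norm : 1 ≤ ‖spacetimeRoot ζ ‖w‖ ^ 2‖ := by
    rw [norm_pow]
    exact one_le_pow₀ (hroot_one.trans (Complex.re_le_norm _))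
  have hbessel : ‖besselKIntegral 2 (m * spacetimeRoot ζ ‖w‖)‖ ≤
      Real.exp (m + m * |ζ.re|) * C * Real.exp (-m * ‖w‖) := by
    refine (norm_besselKIntegral_le 2 hm ?_).trans ?_
    · rw [Complex.re_ofReal_mul]
      nlinarith
    · rw [Complex.re_ofReal_mul, mul_right_comm, ← Real.exp_add]
      gcongr
      nlinarith
  rw [timeKernel_eq_kernelOfRoot,
    kernelOfRoot_of_re_pos hm ζ (zero_lt_one.trans_le hroot_one), norm_mul,
    norm_div (_ * besselKIntegral _ _), norm_mul (_ ^ 2) (besselKIntegral _ _), norm_pow (m : ℂ),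
    Complex.norm_real, Real.norm_of_nonneg hm.le, Real.norm_of_nonneg (Real.exp_pos _).le,
    mul_assoc, mul_assoc (m ^ 2)]
  gcongr
  exact (div_le_self (by positivity) hroot_norm).trans (by gcongr)

theorem integrable_timeKernel (hm : 0 < m) {ζ : ℂ} (hζ : ζ.im ≠ 0) :
    Integrable (timeKernel m ζ) :=
  (continuous_timeKernel hm hζ).locallyIntegrable.integrable_of_isBigO_cocompact
    (isBigO_timeKernel hm hζ) ((integrable_exp_neg_mul_norm volume hm).integrableAtFilter _)

theorem tendsto_timeKernel (hm : 0 < m) {t : ℝ} {w : Space3} (hw : ‖w‖ ≠ |t|) :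
    Tendsto (fun ε : ℝ => timeKernel m (t - ε * Complex.I) w) (𝓝[>] 0)
      (𝓝 (realTimeKernel m t w)) := by
  have hroot := tendsto_spacetimeRoot_lightConeRoot hw
  have hroot_mem : ∀ᶠ ε : ℝ in 𝓝[>] 0, 0 < (spacetimeRoot (t - ε * Complex.I) ‖w‖).re := by
    filter_upwards [self_mem_nhdsWithin] with ε hε
    exact re_spacetimeRoot_pos (by simpa using (Set.mem_Ioi.1 hε).ne') _
  have hlim_mem : 0 ≤ (lightConeRoot t w).re ∧ lightConeRoot t w ≠ 0 := by
    refine ⟨ge_of_tendsto ((Complex.continuous_re.tendsto _).comp hroot)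
      (hroot_mem.mono fun ε h => h.le), fun h => ofReal_sq_sub_sq_ne_zero (r := ‖w‖) (ζ := t)
        (by simpa using hw) ?_⟩
    rw [← lightConeRoot_sq hw, h, zero_pow two_ne_zero]
  simp only [timeKernel_eq_kernelOfRoot]
  rw [realTimeKernel_eq_kernelOfRoot m hw]
  have hpair : Tendsto (fun ε : ℝ => ((t : ℂ) - ε * Complex.I,
      spacetimeRoot (t - ε * Complex.I) ‖w‖)) (𝓝[>] 0)
      (𝓝[{x | 0 ≤ x.2.re ∧ x.2 ≠ 0}] ((t : ℂ), lightConeRoot t w)) :=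
    tendsto_nhdsWithin_iff.2 ⟨(tendsto_ofReal_sub_mul_I t).prodMk_nhds hroot,
      hroot_mem.mono fun ε h => ⟨h.le, Complex.ne_zero_of_re_pos h⟩⟩
  simpa only [Function.comp_def] using
    (continuousOn_kernelOfRoot hm _ hlim_mem).tendsto.comp hpair

theorem isCompact_setOf_sq_mem {V : Set ℂ} (hV : IsCompact V) : IsCompact {q : ℂ | q ^ 2 ∈ V} := by
  obtain ⟨C, hC⟩ := isBounded_iff_forall_norm_le.1 hV.isBounded
  refine Metric.isCompact_of_isClosed_isBounded (hV.isClosed.preimage (by fun_prop))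
    (isBounded_iff_forall_norm_le.2 ⟨Real.sqrt C, fun q hq => Real.le_sqrt_of_sq_le ?_⟩)
  rw [← norm_pow]
  exact hC _ hq

theorem exists_norm_timeKernel_le (hm : 0 < m) (t : ℝ) {K : Set Space3} (hK : IsCompact K)
    (hcone : ∀ w ∈ K, ‖w‖ ≠ |t|) :
    ∃ C, ∀ w ∈ K, ∀ ε ∈ Set.Ioc (0 : ℝ) 1, ‖timeKernel m (t - ε * Complex.I) w‖ ≤ C := by
  have htimes : IsCompact ((fun ε : ℝ => (t : ℂ) - ε * Complex.I) '' Set.Icc 0 1) :=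
    isCompact_Icc.image (by fun_prop)
  set squares : Set ℂ := (fun x : ℝ × Space3 =>
    (‖x.2‖ : ℂ) ^ 2 - (t - x.1 * Complex.I) ^ 2) '' (Set.Icc 0 1 ×ˢ K)
  have hsquares : IsCompact squares :=
    (isCompact_Icc.prod hK).image (by fun_prop)
  have hroots := (isCompact_setOf_sq_mem hsquares).inter_right
    (isClosed_le (continuous_const (y := (0 : ℝ))) Complex.continuous_re)
  have hroots_ne : ∀ q : ℂ, q ^ 2 ∈ squares → q ≠ 0 := by
    rintro q ⟨⟨ε, w⟩, ⟨-, hw⟩, hsq⟩ rfl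
    rw [zero_pow two_ne_zero] at hsq
    exact ofReal_sq_sub_sq_ne_zero (by simpa using hcone w hw) hsq
  obtain ⟨C, hC⟩ := (htimes.prod hroots).exists_bound_of_continuousOn
    ((continuousOn_kernelOfRoot hm).mono fun x hx => ⟨hx.2.2, hroots_ne _ hx.2.1⟩)
  refine ⟨C, fun w hw ε hε => ?_⟩
  rw [timeKernel_eq_kernelOfRoot]
  have hε' := Set.Ioc_subset_Icc_self hε
  exact hC (_, _) ⟨⟨ε, hε', rfl⟩, ⟨(ε, w), ⟨hε', hw⟩, (spacetimeRoot_sq _ _).symm⟩,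
    (re_spacetimeRoot_pos (by simpa using hε.1.ne') _).le⟩

end TimeKernel

section GaussianFourier

variable {V : Type*} [NormedAddCommGroup V] [InnerProductSpace ℝ V] [FiniteDimensional ℝ V]
  [MeasurableSpace V] [BorelSpace V]

theorem fourierInv_exp_neg_mul_norm_smul_sq {b : ℝ} (hb : 0 < b) (w : V) :
    𝓕⁻ (fun ξ : V => ((Real.exp (-(b * ‖(2 * Real.pi) • ξ‖ ^ 2)) : ℝ) : ℂ)) w =
      (((4 * Real.pi * b) ^ (-(Module.finrank ℝ V / 2) : ℝ) *
        Real.exp (-(‖w‖ ^ 2 / (4 * b))) : ℝ) : ℂ) := by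
  have hscale : 0 < (((4 * Real.pi ^ 2 * b : ℝ) : ℂ)).re := by
    rw [Complex.ofReal_re]
    positivity
  have hgauss := fourier_gaussian_innerProductSpace hscale (-w)
  rw [← Real.fourierInv_eq_fourier_neg, norm_neg] at hgauss
  have hfun : (fun ξ : V => ((Real.exp (-(b * ‖(2 * Real.pi) • ξ‖ ^ 2)) : ℝ) : ℂ)) =
      fun ξ => Complex.exp (-(4 * Real.pi ^ 2 * b : ℝ) * ‖ξ‖ ^ 2) := by
    funext ξ
    rw [norm_smul, Real.norm_of_nonneg (by positivity)]
    push_cast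
    ring_nf
  have hbase : (Real.pi / (4 * Real.pi ^ 2 * b : ℝ) : ℂ) = ((4 * Real.pi * b)⁻¹ : ℝ) := by
    push_cast
    have := Complex.ofReal_ne_zero.2 Real.pi_ne_zero
    field_simp
  rw [hfun, hgauss, hbase, Real.rpow_neg (by positivity), ← Real.inv_rpow (by positivity),
    Complex.ofReal_mul _ (Real.exp _), Complex.ofReal_cpow (by positivity), Complex.ofReal_exp]
  have := Complex.ofReal_ne_zero.2 Real.pi_ne_zero
  have := Complex.ofReal_ne_zero.2 hb.ne'
  push_cast
  congr 2
  field_simp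

theorem fourierInv_const_smul {E : Type*} [NormedAddCommGroup E] [NormedSpace ℂ E] (c : ℂ)
    (f : V → E) : 𝓕⁻ (c • f) = c • 𝓕⁻ f :=
  VectorFourier.fourierIntegral_const_smul Real.fourierChar volume (-innerₗ V) f c

theorem fourierInv_integral {X E : Type*} [MeasurableSpace X] {μ : Measure X} [SFinite μ]
    [NormedAddCommGroup E] [NormedSpace ℂ E] {F : V → X → E}
    (hF : Integrable (Function.uncurry F) (volume.prod μ)) (w : V) :
    𝓕⁻ (fun ξ => ∫ x, F ξ x ∂μ) w = ∫ x, 𝓕⁻ (fun ξ => F ξ x) w ∂μ := by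
  simp only [Real.fourierInv_eq', ← integral_smul]
  have hphase : Continuous fun ξ : V => Complex.exp ((2 * Real.pi * inner ℝ ξ w : ℝ) * Complex.I) :=
    by fun_prop
  exact integral_integral_swap (hF.bdd_smul 1 hphase.aestronglyMeasurable.comp_fst
    (Eventually.of_forall fun p => (Complex.norm_exp_ofReal_mul_I _).le))

end GaussianFourier

section KernelFourier

/-- The weight of the Gaussian `exp (-ω² exp u)` in the subordination formula for `exp (-s ω)`,
multiplied by that Gaussian and with the constant `s / (2 √π)` left out. -/
noncomputable def subordinationDensity (s ω u : ℝ) : ℝ :=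
  Real.exp (-(1 / 2) * u - (s / 2) ^ 2 * Real.exp (-u) - ω ^ 2 * Real.exp u)

theorem integrable_subordinationDensity {s ω : ℝ} (hs : 0 < s) (hω : 0 < ω) :
    Integrable (subordinationDensity s ω) :=
  integrable_exp_mul_sub_exp_neg_sub_exp (half_pos hs) hω _

theorem integral_subordinationDensity {s ω : ℝ} (hs : 0 < s) (hω : 0 < ω) :
    ∫ u, subordinationDensity s ω u = 2 * Real.sqrt Real.pi / s * Real.exp (-(s * ω)) := by
  refine (integral_exp_neg_half_subordination (half_pos hs) hω).trans ?_
  field_simp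

theorem integrable_timePhase (m : ℝ) {ζ : ℂ} (hζ : ζ.im < 0) : Integrable (timePhase m ζ) := by
  refine (integrable_exp_neg_mul_norm volume (neg_pos.2 hζ)).mono'
    (continuous_timePhase m ζ).aestronglyMeasurable (Eventually.of_forall fun ξ => ?_)
  have hnorm : ‖ξ‖ ≤ energy m ((2 * Real.pi) • ξ) := by
    refine le_trans ?_ (norm_le_energy m _)
    rw [norm_smul, Real.norm_of_nonneg (by positivity)]
    exact le_mul_of_one_le_left (norm_nonneg ξ) (by linarith [Real.pi_gt_three])
  rw [norm_timePhase, neg_neg, Real.exp_le_exp]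
  exact mul_le_mul_of_nonpos_left hnorm hζ.le

theorem timePhase_neg_I_mul (m s : ℝ) (ξ : Space3) :
    timePhase m (-(Complex.I * s)) ξ = (Real.exp (-(s * energy m ((2 * Real.pi) • ξ))) : ℝ) := by
  rw [timePhase, mul_neg, ← mul_assoc, Complex.I_mul_I]
  push_cast
  ring_nf

section

variable {m s : ℝ}

theorem integrable_uncurry_subordinationDensity (hm : 0 < m) (hs : 0 < s) :
    Integrable (Function.uncurry fun (ξ : Space3) (u : ℝ) =>
      (subordinationDensity s (energy m ((2 * Real.pi) • ξ)) u : ℂ)) (volume.prod volume) := by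
  have henergy := continuous_energy m
  have hcont : Continuous (Function.uncurry fun (ξ : Space3) (u : ℝ) =>
      (subordinationDensity s (energy m ((2 * Real.pi) • ξ)) u : ℂ)) := by
    unfold subordinationDensity
    fun_prop
  rw [integrable_prod_iff hcont.aestronglyMeasurable]
  have hslice (ξ : Space3) :=
    (integrable_subordinationDensity hs (energy_pos hm ((2 * Real.pi) • ξ))).ofReal (𝕜 := ℂ)
  have hmass (ξ : Space3) :
      ∫ u, ‖(subordinationDensity s (energy m ((2 * Real.pi) • ξ)) u : ℂ)‖ =
        2 * Real.sqrt Real.pi / s * ‖timePhase m (-(Complex.I * s)) ξ‖ := by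
    rw [timePhase_neg_I_mul, Complex.norm_real, Real.norm_of_nonneg (Real.exp_pos _).le,
      ← integral_subordinationDensity hs (energy_pos hm _)]
    simp only [Complex.norm_real, Real.norm_of_nonneg (Real.exp_pos _).le, subordinationDensity]
  refine ⟨Eventually.of_forall hslice, ?_⟩
  simpa only [Function.uncurry_apply_pair, hmass] using
    (integrable_timePhase m (by simpa using hs)).norm.const_mul _

theorem timePhase_neg_I_mul_eq_integral (hm : 0 < m) (hs : 0 < s) :
    timePhase m (-(Complex.I * s)) = ((s / (2 * Real.sqrt Real.pi) : ℝ) : ℂ) • fun ξ =>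
      ∫ u, (subordinationDensity s (energy m ((2 * Real.pi) • ξ)) u : ℂ) := by
  funext ξ
  rw [Pi.smul_apply, integral_complex_ofReal, integral_subordinationDensity hs (energy_pos hm _),
    timePhase_neg_I_mul, smul_eq_mul, ← Complex.ofReal_mul]
  congr 1
  field_simp

theorem fourierInv_subordinationDensity (m s : ℝ) (w : Space3) (u : ℝ) :
    𝓕⁻ (fun ξ => (subordinationDensity s (energy m ((2 * Real.pi) • ξ)) u : ℂ)) w =
      ((4 * Real.pi) ^ (-(3 / 2) : ℝ) * Real.exp (-2 * u -
        (Real.sqrt (‖w‖ ^ 2 + s ^ 2) / 2) ^ 2 * Real.exp (-u) - m ^ 2 * Real.exp u) : ℝ) := by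
  have hsplit : (fun ξ => (subordinationDensity s (energy m ((2 * Real.pi) • ξ)) u : ℂ)) =
      (subordinationDensity s m u : ℂ) • fun ξ : Space3 =>
        ((Real.exp (-(Real.exp u * ‖(2 * Real.pi) • ξ‖ ^ 2)) : ℝ) : ℂ) := by
    funext ξ
    rw [Pi.smul_apply, smul_eq_mul, ← Complex.ofReal_mul, subordinationDensity,
      subordinationDensity, ← Real.exp_add, energy_sq]
    ring_nf
  have hpow : (4 * Real.pi * Real.exp u) ^ (-(3 / 2) : ℝ) =
      (4 * Real.pi) ^ (-(3 / 2) : ℝ) * Real.exp (-(3 / 2) * u) := by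
    rw [Real.mul_rpow (by positivity) (Real.exp_pos u).le, ← Real.exp_mul, mul_comm u]
  rw [hsplit, fourierInv_const_smul, Pi.smul_apply,
    fourierInv_exp_neg_mul_norm_smul_sq (Real.exp_pos u), finrank_euclideanSpace_fin, smul_eq_mul,
    ← Complex.ofReal_mul, Nat.cast_ofNat, hpow, subordinationDensity,
    mul_left_comm, mul_assoc, mul_left_comm (Real.exp _), ← Real.exp_add, ← Real.exp_add,
    div_pow (Real.sqrt _), Real.sq_sqrt (by positivity), ← div_div,
    div_eq_mul_inv _ (Real.exp u), ← Real.exp_neg]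
  ring_nf

theorem fourierInv_timePhase_neg_I_mul (hm : 0 < m) (hs : 0 < s) (w : Space3) :
    𝓕⁻ (timePhase m (-(Complex.I * s))) w = timeKernel m (-(Complex.I * s)) w := by
  have hR : 0 < Real.sqrt (‖w‖ ^ 2 + s ^ 2) := Real.sqrt_pos.2 (by positivity)
  have hpow : (4 * Real.pi) ^ (-(3 / 2) : ℝ) = (8 * Real.pi * Real.sqrt Real.pi)⁻¹ := by
    rw [Real.rpow_neg (by positivity), show (3 / 2 : ℝ) = 1 + 1 / 2 by norm_num,
      Real.rpow_add (by positivity), Real.rpow_one, ← Real.sqrt_eq_rpow,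
      Real.sqrt_mul (by norm_num), show (4 : ℝ) = 2 ^ 2 by norm_num, Real.sqrt_sq two_pos.le]
    ring_nf
  rw [timePhase_neg_I_mul_eq_integral hm hs, fourierInv_const_smul, Pi.smul_apply,
    fourierInv_integral (integrable_uncurry_subordinationDensity hm hs)]
  simp only [fourierInv_subordinationDensity]
  set R := Real.sqrt (‖w‖ ^ 2 + s ^ 2)
  have hroot : spacetimeRoot (-(Complex.I * s)) ‖w‖ = R := spacetimeRoot_neg_I_mul s ‖w‖
  rw [integral_complex_ofReal, integral_const_mul, Complex.ofReal_mul,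
    integral_exp_mul_sub_exp_neg_sub_exp (half_pos hR) hm, besselKIntegral_neg,
    timeKernel_eq_kernelOfRoot, hroot,
    kernelOfRoot_of_re_pos hm _ (by simpa using hR), hpow, Real.rpow_neg (by positivity),
    Real.rpow_two, show 2 * (R / 2) * m = m * R by ring]
  push_cast
  rw [smul_eq_mul, mul_neg, ← mul_assoc Complex.I, Complex.I_mul_I]
  have hsqrt : ((Real.sqrt Real.pi : ℝ) : ℂ) ^ 2 = Real.pi := by
    rw [← Complex.ofReal_pow, Real.sq_sqrt Real.pi_nonneg]
  field_simp
  rw [hsqrt]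
  ring

end

theorem eqOn_im_neg_of_eq_neg_I_mul {E : Type*} [NormedAddCommGroup E] [NormedSpace ℂ E]
    [CompleteSpace E] {f g : ℂ → E} (hf : DifferentiableOn ℂ f {ζ | ζ.im < 0})
    (hg : DifferentiableOn ℂ g {ζ | ζ.im < 0})
    (heq : ∀ s : ℝ, 0 < s → f (-(Complex.I * s)) = g (-(Complex.I * s))) :
    Set.EqOn f g {ζ | ζ.im < 0} := by
  have hopen : IsOpen {ζ : ℂ | ζ.im < 0} := isOpen_lt Complex.continuous_im continuous_const
  have haxis : Tendsto (fun s : ℝ => -(Complex.I * s)) (𝓝[>] 1)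
      (𝓝[≠] (-(Complex.I * (1 : ℝ)))) := by
    refine tendsto_nhdsWithin_iff.2
      ⟨(Continuous.tendsto (by fun_prop) (1 : ℝ)).mono_left nhdsWithin_le_nhds, ?_⟩
    filter_upwards [self_mem_nhdsWithin] with s hs
    simpa using (Set.mem_Ioi.1 hs).ne'
  refine (hf.analyticOnNhd hopen).eqOn_of_preconnected_of_frequently_eq (hg.analyticOnNhd hopen)
    (convex_halfSpace_im_lt 0).isPreconnected (z₀ := -(Complex.I * (1 : ℝ))) (by simp)
    (haxis.frequently (Eventually.frequently ?_))
  filter_upwards [self_mem_nhdsWithin] with s hs using heq s (zero_lt_one.trans hs)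

theorem differentiableOn_fourierInv_timePhase (m : ℝ) (w : Space3) :
    DifferentiableOn ℂ (fun ζ => 𝓕⁻ (timePhase m ζ) w) {ζ | ζ.im < 0} := by
  have henergy := continuous_energy m
  have hphase : Continuous fun ξ : Space3 =>
    Complex.exp ((2 * Real.pi * inner ℝ ξ w : ℝ) * Complex.I) := by fun_prop
  have hint (z : ℂ) (hz : 0 < z.re) : Integrable fun ξ : Space3 =>
      Complex.exp (-z * energy m ((2 * Real.pi) • ξ)) *
        Complex.exp ((2 * Real.pi * inner ℝ ξ w : ℝ) * Complex.I) := by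
    have hdecay := integrable_timePhase m (ζ := -(Complex.I * z)) (by simpa using hz)
    refine (hdecay.mul_bdd (c := 1) hphase.aestronglyMeasurable
      (Eventually.of_forall fun ξ => (Complex.norm_exp_ofReal_mul_I _).le)).congr
      (Eventually.of_forall fun ξ => ?_)
    simp only [timePhase, mul_neg, ← mul_assoc, Complex.I_mul_I, neg_mul, one_mul, neg_neg]
  have hlaplace := differentiableOn_integral_cexp_neg_mul
    (φ := fun ξ : Space3 => energy m ((2 * Real.pi) • ξ))
    (Continuous.aestronglyMeasurable (by fun_prop))
    (Eventually.of_forall fun ξ => Real.sqrt_nonneg _) hint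
  refine (hlaplace.comp (f := fun ζ : ℂ => Complex.I * ζ) (by fun_prop)
    fun ζ hζ => by simpa using hζ).congr fun ζ _ => ?_
  simp only [Real.fourierInv_eq', smul_eq_mul, timePhase, Function.comp_apply, mul_comm]

theorem fourierInv_timePhase {m : ℝ} (hm : 0 < m) {ζ : ℂ} (hζ : ζ.im < 0) :
    𝓕⁻ (timePhase m ζ) = timeKernel m ζ := by
  funext w
  exact eqOn_im_neg_of_eq_neg_I_mul (differentiableOn_fourierInv_timePhase m w)
    ((differentiableOn_timeKernel hm w).mono fun ζ hζ => hζ.ne)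
    (fun s hs => fourierInv_timePhase_neg_I_mul hm hs w) hζ

end KernelFourier

section BoundaryValue

variable {m : ℝ}

theorem integral_timeKernel_mul (hm : 0 < m) {ζ : ℂ} (hζ : ζ.im < 0) (f : 𝓢(Space3, ℂ)) :
    ∫ w, timeKernel m ζ w * f w = ∫ ξ, timePhase m ζ ξ * 𝓕⁻ f ξ := by
  have hflip : (-innerₗ Space3).flip = -innerₗ Space3 := by
    ext x y
    simp [real_inner_comm]
  have hswap := VectorFourier.integral_fourierIntegral_smul_eq_flip (e := Real.fourierChar)
    (L := -innerₗ Space3) (μ := volume) (ν := volume) (f := timePhase m ζ) (g := f)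
    Real.continuous_fourierChar (by simp only [LinearMap.neg_apply, innerₗ_apply_apply]; fun_prop)
    (integrable_timePhase m hζ) f.integrable
  rw [hflip] at hswap
  rw [← fourierInv_timePhase hm hζ, SchwartzMap.fourierInv_coe]
  exact hswap

theorem norm_timePhase_le_one (m : ℝ) {ζ : ℂ} (hζ : ζ.im ≤ 0) (ξ : Space3) :
    ‖timePhase m ζ ξ‖ ≤ 1 := by
  rw [norm_timePhase, Real.exp_le_one_iff]
  exact mul_nonpos_of_nonpos_of_nonneg hζ (Real.sqrt_nonneg _)

theorem tendsto_integral_timeKernel (hm : 0 < m) (t : ℝ) (f : 𝓢(Space3, ℂ)) :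
    Tendsto (fun ε : ℝ => ∫ w : Space3, timeKernel m (t - ε * Complex.I) w * f w)
      (𝓝[>] 0) (𝓝 (timeDistribution hm t f)) := by
  have him : ∀ᶠ ε : ℝ in 𝓝[>] 0, ((t : ℂ) - ε * Complex.I).im < 0 := by
    filter_upwards [self_mem_nhdsWithin] with ε hε using by simpa using hε
  have hphase (ξ : Space3) : Continuous fun ζ => timePhase m ζ ξ := by
    unfold timePhase
    fun_prop
  rw [timeDistribution_apply]
  refine Tendsto.congr' (him.mono fun ε hε => (integral_timeKernel_mul hm hε f).symm) ?_
  refine tendsto_integral_filter_of_dominated_convergence (fun ξ => ‖𝓕⁻ f ξ‖)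
    (Eventually.of_forall fun ε =>
      ((continuous_timePhase m _).mul (𝓕⁻ f).continuous).aestronglyMeasurable)
    (him.mono fun ε hε => Eventually.of_forall fun ξ => ?_) (𝓕⁻ f).integrable.norm
    (Eventually.of_forall fun ξ =>
      (((hphase ξ).tendsto _).comp (tendsto_ofReal_sub_mul_I t)).mul_const _)
  rw [norm_mul]
  exact mul_le_of_le_one_left (norm_nonneg _) (norm_timePhase_le_one m hε.le ξ)

theorem tendsto_timeKernel_mul (hm : 0 < m) {t : ℝ} {f : 𝓢(Space3, ℂ)}
    (hcone : ∀ w ∈ tsupport f, ‖w‖ ≠ |t|) (w : Space3) :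
    Tendsto (fun ε : ℝ => timeKernel m (t - ε * Complex.I) w * f w) (𝓝[>] 0)
      (𝓝 (realTimeKernel m t w * f w)) := by
  by_cases hw : w ∈ tsupport f
  · exact (tendsto_timeKernel hm (hcone w hw)).mul_const _
  · simp [image_eq_zero_of_notMem_tsupport hw]

theorem exists_norm_timeKernel_mul_le (hm : 0 < m) (t : ℝ) {f : 𝓢(Space3, ℂ)}
    (hf : HasCompactSupport f) (hcone : ∀ w ∈ tsupport f, ‖w‖ ≠ |t|) :
    ∃ C, ∀ᶠ ε : ℝ in 𝓝[>] 0, ∀ w, ‖timeKernel m (t - ε * Complex.I) w * f w‖ ≤ C * ‖f w‖ := by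
  obtain ⟨C, hC⟩ := exists_norm_timeKernel_le hm t hf.isCompact hcone
  refine ⟨C, ?_⟩
  filter_upwards [Ioc_mem_nhdsGT zero_lt_one] with ε hε w
  by_cases hw : w ∈ tsupport f
  · rw [norm_mul]
    gcongr
    exact hC w hw ε hε
  · simp [image_eq_zero_of_notMem_tsupport hw]

theorem timeDistribution_eq_integral (hm : 0 < m) (t : ℝ) (f : 𝓢(Space3, ℂ))
    (hf : HasCompactSupport f) (hcone : ∀ w ∈ tsupport f, ‖w‖ ≠ |t|) :
    Integrable (fun w : Space3 => realTimeKernel m t w * f w) volume ∧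
      timeDistribution hm t f = ∫ w : Space3, realTimeKernel m t w * f w := by
  obtain ⟨C, hbound⟩ := exists_norm_timeKernel_mul_le hm t hf hcone
  have hlim := tendsto_timeKernel_mul hm hcone
  have hdom : Integrable (fun w => C * ‖f w‖) := f.integrable.norm.const_mul C
  have hmeas : ∀ᶠ ε : ℝ in 𝓝[>] 0, AEStronglyMeasurable
      (fun w : Space3 => timeKernel m (t - ε * Complex.I) w * f w) volume := by
    filter_upwards [self_mem_nhdsWithin] with ε hε
    exact ((continuous_timeKernel hm (by simpa using (Set.mem_Ioi.1 hε).ne')).mul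
      f.continuous).aestronglyMeasurable
  have hmeas_lim : AEStronglyMeasurable (fun w : Space3 => realTimeKernel m t w * f w) volume := by
    obtain ⟨u, hu⟩ := (𝓝[>] (0 : ℝ)).exists_seq_tendsto
    obtain ⟨N, hN⟩ := eventually_atTop.1 (hu.eventually hmeas)
    exact aestronglyMeasurable_of_tendsto_ae atTop (fun n => hN (n + N) (Nat.le_add_left N n))
      (Eventually.of_forall fun w => (hlim w).comp (hu.comp (tendsto_add_atTop_nat N)))
  refine ⟨hdom.mono' hmeas_lim (Eventually.of_forall fun w =>
    le_of_tendsto (hlim w).norm (hbound.mono fun ε h => h w)), ?_⟩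
  exact tendsto_nhds_unique (tendsto_integral_timeKernel hm t f)
    (tendsto_integral_filter_of_dominated_convergence _ hmeas
      (hbound.mono fun ε h => Eventually.of_forall h) hdom (Eventually.of_forall hlim))

end BoundaryValue

theorem mainTheorem4 (m : ℝ) (hm : 0 < m) :
    (∀ t : ℝ, ∃ k : 𝓢'(Space3, ℂ),
      (∀ ε : ℝ, 0 < ε → Integrable (timeKernel m (t - ε * Complex.I)) volume) ∧
      (∀ f : 𝓢(Space3, ℂ),
        Tendsto (fun ε : ℝ => ∫ w : Space3, timeKernel m (t - ε * Complex.I) w * f w)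
          (𝓝[>] 0) (𝓝 (k f))) ∧
      (∀ w : Space3, ‖w‖ ≠ |t| →
        Tendsto (fun ε : ℝ => timeKernel m (t - ε * Complex.I) w)
          (𝓝[>] 0) (𝓝 (realTimeKernel m t w))) ∧
      (∀ f : 𝓢(Space3, ℂ), HasCompactSupport f → (∀ w ∈ tsupport f, ‖w‖ ≠ |t|) →
        Integrable (fun w : Space3 => realTimeKernel m t w * f w) volume ∧
        k f = ∫ w : Space3, realTimeKernel m t w * f w) ∧
      (∀ (y : Space3) (f : 𝓢(Space3, ℂ)), ∃ g : 𝓢(Space3, ℂ), IsConvolutionTest k y f g ∧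
        conjOp (translationU m t y) (coordAnnihilation m hm f) = coordAnnihilation m hm g)) ∧
    (∀ (y : Space3) (f : 𝓢(Space3, ℂ)),
      conjOp (translationU m 0 y) (coordAnnihilation m hm f) =
        coordAnnihilation m hm (SchwartzMap.compSubConstCLM ℂ y f)) := by
  refine ⟨fun t => ⟨timeDistribution hm t,
    fun ε hε => integrable_timeKernel hm (by simpa using hε.ne'),
    tendsto_integral_timeKernel hm t, fun w hw => tendsto_timeKernel hm hw,
    timeDistribution_eq_integral hm t, fun y f => ⟨translatedTest m t y f,
      isConvolutionTest_translatedTest hm t y f,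
      conjOp_translationU_coordAnnihilation hm t y f⟩⟩, fun y f => ?_⟩
  rw [← translatedTest_zero m y f]
  exact conjOp_translationU_coordAnnihilation hm 0 y f
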